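/- Let $\mathcal L=\{(n,i,j)\in\mathbb Z^3: n\equiv i+j \bmod 2\}$. Call $(i,j),(i',j')\in\mathbb Z^2$ lattice-adjacent if $|i-i'|+|j-j'|=1$. A pseudo-height function is $h:\mathbb Z^2\to\mathbb Z$ with $|h(P)-h(Q)|=1$ for lattice-adjacent $P,Q$ and $(h(i,j),i,j)\in\mathcal L$ for all $(i,j)$; it is a height function if also $h(i,j)+|i|+|j|\to\infty$ as $|i|+|j|\to\infty$. Let $K$ be the field of rational functions in variables $x(i,j)$ for $(i,j)\in\mathbb Z^2$ and $a(i,j),b(i,j),c(i,j),d(i,j)$ for $i+j$ odd. For a height function $h$ put $\mathcal U=\{(n,i,j)\in\mathcal L: n>h(i,j)\}$ and define $f$ by $f(h(i,j),i,j)=x(i,j)$ and, for $(n,i,j)\in\mathcal U$, $$f(n,i,j)=\frac{a(i+n-1,j)\,c(i-n+1,j)\,f(n-1,i,j+1)\,f(n-1,i,j-1)+b(i,j+n-1)\,d(i,j-n+1)\,f(n-1,i+1,j)\,f(n-1,i-1,j)}{f(n-2,i,j)}.$$ To a pseudo-height function $h$ associate an infinite planar graph $\mathcal G(h)$ with face set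 $\mathbb Z^2$. Two faces $(i_1,j_1),(i_2,j_2)$ border, along exactly one edge, iff they are lattice-adjacent, or $|i_1-i_2|=|j_1-j_2|=1$ and $h(i_1,j_2)\ne h(i_2,j_1)$. In a unit square of four faces, if $h$ is constant on each diagonal there is one vertex, surrounded by all four faces (a cross); otherwise $h$ differs on exactly one diagonal and there are two vertices, each surrounded by one face of that diagonal and both faces of the other one (a wrench), joined by the edge separating the faces of the other diagonal (the middle edge of the wrench). An edge ends at a vertex iff both faces it separates are around that vertex. Middle edges of wrenches have weight $1$. The edge between $(i,j)$ and $(i+1,j)$ has weight $a(i+1+h(i,j),j)$ if $h(i+1,j)>h(i,j)$ and $c(i+1-h(i,j),j)$ otherwise; the edge between $(i,j)$ and $(i,j+1)$ has weight $b(i,j+1+h(i,j))$ if $h(i,j+1)>h(i,j)$ and $d(i,j+1-h(i,j))$ otherwise. A matching is a set $M$ of edges such that every vertex lies on exactly one edge of $M$. Put $$m(M)=\prod_{e\in M}\mathrm{weight}(e)\prod_{(i,j)}x(i,j)^{\epsilon(i,j)},\qquad \epsilon(i,j)=\Big\lceil\tfrac{\beta-\alpha}{2}\Big\rceil-1,$$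 where $\alpha$ (resp. $\beta$) is the number of edges of the face $(i,j)$ in $M$ (resp. not in $M$). Let $h$ be a height function, $(n_0,i_0,j_0)\in\mathcal U$, $p(i,j)=n_0-|i-i_0|-|j-j_0|$ and $\tilde h=\min(h,p)$. Let $G$ consist of all edges of $\mathcal G(h)$ bordering a face $(i,j)$ with $h(i,j)<p(i,j)$, together with their endpoints, viewed as a subgraph of $\tilde{\mathcal G}=\mathcal G(\tilde h)$. Let $G_{\rm out}=\tilde{\mathcal G}\setminus G$ be obtained from $\tilde{\mathcal G}$ by deleting the vertices of $G$, and let $M_{\rm out}$ be the set of the middle edges of all wrenches in $G_{\rm out}$. Call a matching $M$ of $\tilde{\mathcal G}$ acceptable if $M$ coincides with $M_{\rm out}$ for all but finitely many edges. Then: 1. $\tilde h$ is a pseudo-height function, and $M_{\rm out}$ is a matching of $G_{\rm out}$. 2. Every acceptable matching coincides with $M_{\rm out}$ everywhere on $G_{\rm out}$: an edge with an endpoint in $G_{\rm out}$ is in $M$ iff it is in $M_{\rm out}$. 3. For every acceptable $M$, only finitely many factors of $m(M)$ are not trivially $1$ (edges of $M$ of weight $\ne1$, faces with $\epsilon\neq0$);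 there are only finitely many acceptable matchings; and $$f(n_0,i_0,j_0)=\sum_{M\ \mathrm{acceptable}} m(M).$$ -/

import Mathlib

open Filter

/-- Faces are indexed by the points of `ℤ²`. -/
abbrev Face : Type := ℤ × ℤ

/-- The four symbols `a`, `b`, `c`, `d` that name the four families of edge variables. -/
inductive EdgeSymbol : Type
  | a | b | c | d

/-- The index set of the edge variables: `((i, j), q)` with `i + j` odd. -/
abbrev EdgeLabel : Type := {p : ℤ × ℤ // Odd (p.1 + p.2)} × EdgeSymbol

/-- The field of rational functions in all face variables and all edge variables. -/
abbrev OctField : Type := FractionRing (MvPolynomial (Face ⊕ EdgeLabel) ℤ)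

/-- The face variable `x(i,j)`. -/
noncomputable def faceVar (p : Face) : OctField :=
  algebraMap (MvPolynomial (Face ⊕ EdgeLabel) ℤ) OctField (MvPolynomial.X (Sum.inl p))

/-- The edge variable `q(i,j)`. It exists for `i + j` odd only, and is used for such indices only;
the value `1` for even `i + j` is a placeholder. -/
noncomputable def edgeVar (q : EdgeSymbol) (i j : ℤ) : OctField :=
  if hp : Odd (i + j) then
    algebraMap (MvPolynomial (Face ⊕ EdgeLabel) ℤ) OctField
      (MvPolynomial.X (Sum.inr (⟨(i, j), hp⟩, q)))
  else 1

/-- The lattice of all `(n, i, j)` with `n ≡ i + j` modulo 2. -/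
def octLattice : Set (ℤ × ℤ × ℤ) := {v | v.1 ≡ v.2.1 + v.2.2 [ZMOD 2]}

/-- `p_{(n₀,i₀,j₀)}(i,j) = n₀ - |i - i₀| - |j - j₀|`, with apex `P = (n₀, i₀, j₀)`. -/
def coneFun (P : ℤ × ℤ × ℤ) (p : Face) : ℤ := P.1 - |p.1 - P.2.1| - |p.2 - P.2.2|

/-- The cone of `P`. -/
def octCone (P : ℤ × ℤ × ℤ) : Set (ℤ × ℤ × ℤ) := {v | v ∈ octLattice ∧ v.1 ≤ coneFun P v.2}

/-- The inner cone of `P`. -/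
def innerCone (P : ℤ × ℤ × ℤ) : Set (ℤ × ℤ × ℤ) := {v | v ∈ octLattice ∧ v.1 < coneFun P v.2}

def LatticeAdjacent (p q : Face) : Prop := |p.1 - q.1| + |p.2 - q.2| = 1

structure IsPseudoHeightFunction (h : Face → ℤ) : Prop where
  step : ∀ p q : Face, LatticeAdjacent p q → |h p - h q| = 1
  parity : ∀ p : Face, (h p, p) ∈ octLattice

structure IsHeightFunction (h : Face → ℤ) : Prop extends IsPseudoHeightFunction h where
  growth : Tendsto (fun p : Face => h p + |p.1| + |p.2|)
    (comap (fun p : Face => |p.1| + |p.2|) atTop) atTop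

/-- The set of the points of the lattice that lie strictly above the graph of `h`. -/
def upperSet (h : Face → ℤ) : Set (ℤ × ℤ × ℤ) := {v | v ∈ octLattice ∧ h v.2 < v.1}

theorem finite_upperSet_inter_octCone {h : Face → ℤ} (hh : IsHeightFunction h) (P : ℤ × ℤ × ℤ) :
    (upperSet h ∩ octCone P).Finite := by
  obtain ⟨n₀, i₀, j₀⟩ := P
  have h1 := hh.growth.eventually (eventually_ge_atTop (n₀ + |i₀| + |j₀|))
  rw [eventually_comap, eventually_atTop] at h1
  obtain ⟨N, hN⟩ := h1
  have hfin : (⋃ p ∈ (Set.Icc (-N) N ×ˢ Set.Icc (-N) N : Set Face),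
      (fun n : ℤ => (n, p)) '' Set.Icc (h p) (coneFun (n₀, i₀, j₀) p)).Finite := by
    refine Set.Finite.biUnion ((Set.finite_Icc _ _).prod (Set.finite_Icc _ _)) ?_
    intro p _
    exact (Set.finite_Icc _ _).image _
  refine hfin.subset ?_
  rintro ⟨n, i, j⟩ ⟨⟨_, hu⟩, ⟨_, hc⟩⟩
  simp only [coneFun] at hu hc
  have hlt : |i| + |j| < N := by
    by_contra hcon
    push Not at hcon
    have h2 := hN _ hcon (i, j) rfl
    simp only at h2
    have h3 : |i| - |i₀| ≤ |i - i₀| := abs_sub_abs_le_abs_sub i i₀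
    have h4 : |j| - |j₀| ≤ |j - j₀| := abs_sub_abs_le_abs_sub j j₀
    linarith
  have hi : |i| ≤ N := by linarith [abs_nonneg j]
  have hj : |j| ≤ N := by linarith [abs_nonneg i]
  simp only [Set.mem_iUnion, Set.mem_image, Set.mem_Icc, Set.mem_prod]
  refine ⟨(i, j), ⟨abs_le.mp hi, abs_le.mp hj⟩, n, ⟨hu.le, hc⟩, rfl⟩

theorem ncard_upperSet_inter_octCone_lt {h : Face → ℤ} (hh : IsHeightFunction h)
    {n i j n' i' j' : ℤ} (hP : (n, i, j) ∈ upperSet h) (hlt : n' < n)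
    (hle : n' + |i' - i| + |j' - j| ≤ n) :
    (upperSet h ∩ octCone (n', i', j')).ncard < (upperSet h ∩ octCone (n, i, j)).ncard := by
  refine Set.ncard_lt_ncard ?_ (finite_upperSet_inter_octCone hh _)
  refine ⟨?_, ?_⟩
  · rintro ⟨m, k, l⟩ ⟨hu, hL, hc⟩
    refine ⟨hu, hL, ?_⟩
    simp only [coneFun] at hc ⊢
    have h1 := abs_sub_le k i' i
    have h2 := abs_sub_le l j' j
    linarith
  · intro hsub
    have hmem : (n, i, j) ∈ upperSet h ∩ octCone (n, i, j) :=
      ⟨hP, hP.1, by simp [coneFun]⟩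
    obtain ⟨_, _, hc⟩ := hsub hmem
    simp only [coneFun] at hc
    have h1 := abs_nonneg (i - i')
    have h2 := abs_nonneg (j - j')
    linarith

open Classical in
/-- The solution `f(n,i,j)` of the octahedron recurrence with the initial values
`f(h(i,j),i,j) = x(i,j)`. Only the values at the lattice points `(n, i, j)` with `h(i,j) ≤ n` are
meaningful, and only such values enter the recurrence at a point of `upperSet h`. -/
noncomputable def octF (h : Face → ℤ) (hh : IsHeightFunction h) (n i j : ℤ) : OctField :=
  if _hP : (n, i, j) ∈ upperSet h then
    (edgeVar .a (i + n - 1) j * edgeVar .c (i - n + 1) j *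
        octF h hh (n - 1) i (j + 1) * octF h hh (n - 1) i (j - 1) +
      edgeVar .b i (j + n - 1) * edgeVar .d i (j - n + 1) *
        octF h hh (n - 1) (i + 1) j * octF h hh (n - 1) (i - 1) j) / octF h hh (n - 2) i j
  else faceVar (i, j)
termination_by (upperSet h ∩ octCone (n, i, j)).ncard
decreasing_by
  all_goals
    refine ncard_upperSet_inter_octCone_lt hh _hP (by omega) ?_
    simp

/-! ### The crosses-and-wrenches graph of a pseudo-height function

The graph is described through its dual. Its faces are the points of `ℤ²` (all of them closed).
An edge is the unordered pair of the two faces that it separates. A vertex is the set of the faces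
around it; thus an edge ends at a vertex exactly if both of its faces lie around that vertex. -/

/-- Two faces border (along exactly one edge). -/
def Borders (h : Face → ℤ) (p q : Face) : Prop :=
  LatticeAdjacent p q ∨
    (|p.1 - q.1| = 1 ∧ |p.2 - q.2| = 1 ∧ h (p.1, q.2) ≠ h (q.1, p.2))

/-- The edges of the graph of `h`. -/
def graphEdges (h : Face → ℤ) : Set (Sym2 Face) := {e | ∃ p q, e = s(p, q) ∧ Borders h p q}

/-- The vertices of the graph of `h`. A unit square of faces on both of whose diagonals `h` is
constant contains a cross: one vertex, surrounded by all four faces. Otherwise `h` differs on one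
diagonal, and the square contains a wrench: two vertices, each of them surrounded by one face of
that diagonal and both faces of the other diagonal. -/
def graphVertices (h : Face → ℤ) : Set (Finset Face) :=
  {v | ∃ i j : ℤ,
    (h (i, j) = h (i + 1, j + 1) ∧ h (i + 1, j) = h (i, j + 1) ∧
      v = {(i, j), (i + 1, j), (i, j + 1), (i + 1, j + 1)}) ∨
    (h (i, j) ≠ h (i + 1, j + 1) ∧
      (v = {(i, j), (i + 1, j), (i, j + 1)} ∨ v = {(i + 1, j + 1), (i + 1, j), (i, j + 1)})) ∨
    (h (i + 1, j) ≠ h (i, j + 1) ∧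
      (v = {(i + 1, j), (i, j), (i + 1, j + 1)} ∨ v = {(i, j + 1), (i, j), (i + 1, j + 1)}))}

/-- The edge `e` has the vertex `v` as an endpoint. -/
def EndsAt (e : Sym2 Face) (v : Finset Face) : Prop := ∀ p ∈ e, p ∈ v

/-- The unweighted edges of the graph of `h`: the middle edges of the wrenches, that is, the edges
that separate two faces which are not lattice-adjacent. -/
def unweightedEdges (h : Face → ℤ) : Set (Sym2 Face) :=
  {e | e ∈ graphEdges h ∧ ∃ p q, e = s(p, q) ∧ ¬ LatticeAdjacent p q}

/-- `M` is a matching of the graph with vertex set `V` and edge set `E`. -/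
def IsMatchingOf (V : Set (Finset Face)) (E : Set (Sym2 Face)) (M : Set (Sym2 Face)) : Prop :=
  M ⊆ E ∧ ∀ v ∈ V, ∃! e, e ∈ M ∧ EndsAt e v

/-- The variable attached to the edge between `p` and `q` if `q` is the right or the upper
lattice neighbour of `p`, and `1` otherwise. -/
noncomputable def orientedWeight (h : Face → ℤ) (p q : Face) : OctField :=
  if q = (p.1 + 1, p.2) then
    if h p < h q then edgeVar .a (q.1 + h p) q.2 else edgeVar .c (q.1 - h p) q.2
  else if q = (p.1, p.2 + 1) then
    if h p < h q then edgeVar .b q.1 (q.2 + h p) else edgeVar .d q.1 (q.2 - h p)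
  else 1

/-- The variable attached to an edge, and `1` for an unweighted edge. At most one of the two
factors differs from `1`. -/
noncomputable def edgeWeight (h : Face → ℤ) : Sym2 Face → OctField :=
  Sym2.lift ⟨fun p q => orientedWeight h p q * orientedWeight h q p, fun _ _ => mul_comm _ _⟩

/-- The edges of the (closed) face `p`. -/
def faceEdges (h : Face → ℤ) (p : Face) : Set (Sym2 Face) := {e | e ∈ graphEdges h ∧ p ∈ e}

/-- The exponent `⌈(b - a) / 2⌉ - 1` of a (closed) face, where `a` of its edges lie in `M` and `b`
of its edges do not. -/
noncomputable def faceExponent (h : Face → ℤ) (M : Set (Sym2 Face)) (p : Face) : ℤ :=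
  ⌈(((faceEdges h p \ M).ncard : ℚ) - ((faceEdges h p ∩ M).ncard : ℚ)) / 2⌉ - 1

/-- The matching monomial of `M`. -/
noncomputable def matchingMonomial (h : Face → ℤ) (M : Set (Sym2 Face)) : OctField :=
  (∏ᶠ e ∈ M, edgeWeight h e) * ∏ᶠ p : Face, faceVar p ^ faceExponent h M p

/-! ### The graph at an apex, the truncated height function, acceptable matchings -/

/-- The closed faces of the graph `G_P`. -/
def closedFaces (h : Face → ℤ) (P : ℤ × ℤ × ℤ) : Set Face := {p | (h p, p) ∈ innerCone P}

/-- The edges of the graph `G_P`. -/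
def subgraphEdges (h : Face → ℤ) (P : ℤ × ℤ × ℤ) : Set (Sym2 Face) :=
  {e | e ∈ graphEdges h ∧ ∃ p ∈ e, p ∈ closedFaces h P}

/-- The truncated function `min(h, p_P)`. -/
def truncated (h : Face → ℤ) (P : ℤ × ℤ × ℤ) (p : Face) : ℤ := min (h p) (coneFun P p)

/-- The vertices of `G_out`, the complement of `G_P` in the graph of `truncated h P`. -/
def outVertices (h : Face → ℤ) (P : ℤ × ℤ × ℤ) : Set (Finset Face) :=
  {v | v ∈ graphVertices (truncated h P) ∧ ∀ e ∈ subgraphEdges h P, ¬ EndsAt e v}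

/-- The edges of `G_out`: the edges of the graph of `truncated h P` with both ends in `G_out`. -/
def outEdges (h : Face → ℤ) (P : ℤ × ℤ × ℤ) : Set (Sym2 Face) :=
  {e | e ∈ graphEdges (truncated h P) ∧
    ∀ v ∈ graphVertices (truncated h P), EndsAt e v → v ∈ outVertices h P}

/-- The standard matching of `G_out`: the middle edges of all wrenches of `G_out`. -/
def outMatching (h : Face → ℤ) (P : ℤ × ℤ × ℤ) : Set (Sym2 Face) :=
  outEdges h P ∩ unweightedEdges (truncated h P)

/-- A matching of the graph of `truncated h P` is acceptable if it coincides with the standard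
matching for all but finitely many edges. -/
def IsAcceptable (h : Face → ℤ) (P : ℤ × ℤ × ℤ) (M : Set (Sym2 Face)) : Prop :=
  IsMatchingOf (graphVertices (truncated h P)) (graphEdges (truncated h P)) M ∧
    (symmDiff M (outMatching h P)).Finite

/-! The apex `P` stays fixed and the initial surface moves. For a pseudo-height function `g` between
`truncated h P` and `coneFun P`, consider the matchings of its graph that differ from the middle
edges of the cone graph in finitely many edges (`ConeMatching`), and sum their monomials with `f(g
p, p)` in place of the variable of the face `p` (`heightMonomial`). This sum does not depend on `g`.
For `g = coneFun P` there is one matching, and its monomial is `f(P)`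
(`finsum_heightMonomial_coneFun`). For `g = truncated h P` all face values are the variables `x`,
and the sum is the asserted one.

The invariance is urban renewal: `g` is raised by 2 at a local minimum `q`
(`finsum_heightMonomial_renewal`). Crosses and wrenches are exchanged at the four corners of `q`,
and only edges in `localEdges q` are affected. Once the rest of a matching is fixed, each corner
prescribes whether one or none of the two edges of `q` there is used (`demand`), and raising
complements this prescription. The resulting sums agree trivially, except for the two constant
prescriptions, where their equality is the octahedron recurrence (`sum_bits_renewal_aux`).

All finiteness rests on rigidity: where `g` is the cone function, a matching that is standard far
away is standard everywhere, because a deviation would propagate outwards for ever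
(`middle_mem_of_outward`). This also gives the assertion about `G_out`, and `isAcceptable_iff`
identifies the acceptable matchings with the cone matchings of `truncated h P`. -/

/-! ### Edges in terms of the four lattice directions. -/

/-- The four unit vectors of `ℤ²` in counterclockwise order. -/
def dir : Fin 4 → Face := ![(1, 0), (0, 1), (-1, 0), (0, -1)]

theorem dir_add_two (k : Fin 4) : dir (k + 2) = -dir k := by revert k; decide

theorem dir_injective : Function.Injective dir := by
  intro k l; revert k l; decide

theorem dir_ne_zero (k : Fin 4) : dir k ≠ 0 := by revert k; decide

theorem latticeAdjacent_iff {p q : Face} : LatticeAdjacent p q ↔ ∃ k, q = p + dir k := by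
  obtain ⟨a, b⟩ := p
  obtain ⟨c, d⟩ := q
  simp only [LatticeAdjacent, Fin.exists_fin_succ, dir, Prod.ext_iff, Prod.fst_add, Prod.snd_add]
  simp
  grind

theorem diagonal_iff {p q : Face} :
    (|p.1 - q.1| = 1 ∧ |p.2 - q.2| = 1) ↔ ∃ k, q = p + dir k + dir (k + 1) := by
  obtain ⟨a, b⟩ := p
  obtain ⟨c, d⟩ := q
  simp only [Fin.exists_fin_succ, dir, Prod.ext_iff, Prod.fst_add, Prod.snd_add]
  simp
  grind

theorem latticeAdjacent_comm {p q : Face} : LatticeAdjacent p q ↔ LatticeAdjacent q p := by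
  simp only [LatticeAdjacent, abs_sub_comm]

theorem not_latticeAdjacent_diagonal (p : Face) (k : Fin 4) :
    ¬ LatticeAdjacent p (p + dir k + dir (k + 1)) := by
  simp only [LatticeAdjacent]
  fin_cases k <;> simp [dir]

theorem borders_iff {h : Face → ℤ} {p q : Face} :
    Borders h p q ↔ (∃ k, q = p + dir k) ∨
      ∃ k, q = p + dir k + dir (k + 1) ∧ h (p + dir k) ≠ h (p + dir (k + 1)) := by
  rw [Borders, latticeAdjacent_iff, ← and_assoc, diagonal_iff]
  refine or_congr_right ?_
  have key : ∀ k, q = p + dir k + dir (k + 1) →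
      (h (p.1, q.2) ≠ h (q.1, p.2) ↔ h (p + dir k) ≠ h (p + dir (k + 1))) := by
    rintro k rfl
    obtain ⟨a, b⟩ := p
    fin_cases k <;> simp [dir, eq_comm]
  constructor
  · rintro ⟨⟨k, hk⟩, hh⟩
    exact ⟨k, hk, (key k hk).1 hh⟩
  · rintro ⟨k, hk, hh⟩
    exact ⟨⟨k, hk⟩, (key k hk).2 hh⟩

theorem borders_comm {h : Face → ℤ} {p q : Face} : Borders h p q ↔ Borders h q p := by
  simp only [Borders, latticeAdjacent_comm (p := p), abs_sub_comm q.1, abs_sub_comm q.2,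
    ne_comm (a := h (p.1, q.2))]

theorem mem_graphEdges {h : Face → ℤ} {p q : Face} : s(p, q) ∈ graphEdges h ↔ Borders h p q := by
  constructor
  · rintro ⟨a, b, hab, hb⟩
    rcases Sym2.eq_iff.1 hab with ⟨rfl, rfl⟩ | ⟨rfl, rfl⟩
    exacts [hb, borders_comm.1 hb]
  · exact fun hb => ⟨p, q, rfl, hb⟩

theorem graphEdges_lattice (h : Face → ℤ) (p : Face) (k : Fin 4) :
    s(p, p + dir k) ∈ graphEdges h :=
  mem_graphEdges.2 (borders_iff.2 (Or.inl ⟨k, rfl⟩))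

theorem graphEdges_diagonal {h : Face → ℤ} {p : Face} {k : Fin 4} :
    s(p, p + dir k + dir (k + 1)) ∈ graphEdges h ↔ h (p + dir k) ≠ h (p + dir (k + 1)) := by
  rw [mem_graphEdges, Borders, or_iff_right (not_latticeAdjacent_diagonal p k)]
  obtain ⟨a, b⟩ := p
  fin_cases k <;> simp [dir, eq_comm]

theorem not_borders_self (h : Face → ℤ) (p : Face) : ¬ Borders h p p := by
  simp [Borders, LatticeAdjacent]

/-! ### The matching condition as linear equations in each unit square. -/

open Classical in
/-- The indicator of the edge between `p` and `q` in `M`. -/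
noncomputable def ind (M : Set (Sym2 Face)) (p q : Face) : ℤ := if s(p, q) ∈ M then 1 else 0

theorem ind_comm (M : Set (Sym2 Face)) (p q : Face) : ind M p q = ind M q p := by
  rw [ind, ind, Sym2.eq_swap]

theorem ind_nonneg (M : Set (Sym2 Face)) (p q : Face) : 0 ≤ ind M p q := by
  rw [ind]; split_ifs <;> norm_num

theorem ind_le_one (M : Set (Sym2 Face)) (p q : Face) : ind M p q ≤ 1 := by
  rw [ind]; split_ifs <;> norm_num

theorem ind_eq_one {M : Set (Sym2 Face)} {p q : Face} : ind M p q = 1 ↔ s(p, q) ∈ M := by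
  rw [ind]; split_ifs with h <;> simp [h]

theorem ind_eq_zero {M : Set (Sym2 Face)} {p q : Face} : ind M p q = 0 ↔ s(p, q) ∉ M := by
  rw [ind]; split_ifs with h <;> simp [h]

theorem ind_congr {M N : Set (Sym2 Face)} {p q : Face} (h : s(p, q) ∈ M ↔ s(p, q) ∈ N) :
    ind M p q = ind N p q := by
  rw [ind, ind]; split_ifs <;> tauto

open Classical in
theorem existsUnique_mem_finset_iff {α : Type*} (M : Set α) (S : Finset α) :
    (∃! e, e ∈ M ∧ e ∈ S) ↔ ∑ e ∈ S, (if e ∈ M then (1 : ℤ) else 0) = 1 := by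
  rw [Finset.sum_boole]
  norm_cast
  rw [Finset.card_eq_one]
  simp only [Finset.ext_iff, Finset.mem_filter, Finset.mem_singleton]
  constructor
  · rintro ⟨e, he, hu⟩
    exact ⟨e, fun a => ⟨fun ha => hu a ha.symm, by rintro rfl; exact he.symm⟩⟩
  · rintro ⟨e, he⟩
    exact ⟨e, ((he e).2 rfl).symm, fun a ha => (he a).1 ha.symm⟩

theorem existsUnique_endsAt_triple {M : Set (Sym2 Face)} (hM : ∀ p, s(p, p) ∉ M) {A B C : Face}
    (hAB : A ≠ B) (hAC : A ≠ C) (hBC : B ≠ C) :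
    (∃! e, e ∈ M ∧ EndsAt e {A, B, C}) ↔ ind M A B + ind M A C + ind M B C = 1 := by
  have h1 : ∀ e, (e ∈ M ∧ EndsAt e {A, B, C}) ↔
      (e ∈ M ∧ e ∈ ({s(A, B), s(A, C), s(B, C)} : Finset (Sym2 Face))) := by
    intro e
    induction e with | _ p q
    refine and_congr_right fun he => ?_
    have hpq : p ≠ q := by rintro rfl; exact hM p he
    simp only [EndsAt, Sym2.mem_iff, forall_eq_or_imp, forall_eq,
      Finset.mem_insert, Finset.mem_singleton, Sym2.eq_iff]
    grind
  simp only [h1]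
  rw [existsUnique_mem_finset_iff, Finset.sum_insert, Finset.sum_insert, Finset.sum_singleton]
  · simp only [ind, add_assoc]
  · simp only [Finset.mem_singleton, Sym2.eq_iff]; grind
  · simp only [Finset.mem_insert, Finset.mem_singleton, Sym2.eq_iff]; grind

/-- Pairs of opposite faces also satisfy `EndsAt`, so they have to be excluded; at a cross they are
not edges. -/
theorem existsUnique_endsAt_quadruple {M : Set (Sym2 Face)} (hM : ∀ p, s(p, p) ∉ M)
    {A B C D : Face} (hAB : A ≠ B) (hAC : A ≠ C) (hBC : B ≠ C) (hAD : A ≠ D) (hBD : B ≠ D)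
    (hCD : C ≠ D) (h1 : s(A, D) ∉ M) (h2 : s(B, C) ∉ M) :
    (∃! e, e ∈ M ∧ EndsAt e {A, B, C, D}) ↔
      ind M A B + ind M A C + ind M D B + ind M D C = 1 := by
  have h1 : ∀ e, (e ∈ M ∧ EndsAt e {A, B, C, D}) ↔
      (e ∈ M ∧ e ∈ ({s(A, B), s(A, C), s(D, B), s(D, C)} : Finset (Sym2 Face))) := by
    intro e
    induction e with | _ p q
    refine and_congr_right fun he => ?_
    have hpq : p ≠ q := by rintro rfl; exact hM p he
    have hpq1 : s(p, q) ≠ s(A, D) := fun h => h1 (h ▸ he)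
    have hpq2 : s(p, q) ≠ s(B, C) := fun h => h2 (h ▸ he)
    simp only [EndsAt, Sym2.mem_iff, forall_eq_or_imp, forall_eq,
      Finset.mem_insert, Finset.mem_singleton, Sym2.eq_iff,
      ne_eq] at hpq1 hpq2 ⊢
    grind
  simp only [h1]
  rw [existsUnique_mem_finset_iff, Finset.sum_insert, Finset.sum_insert, Finset.sum_insert,
    Finset.sum_singleton]
  · simp only [ind, add_assoc]
  · simp only [Finset.mem_singleton, Sym2.eq_iff]; grind
  · simp only [Finset.mem_insert, Finset.mem_singleton, Sym2.eq_iff]; grind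
  · simp only [Finset.mem_insert, Finset.mem_singleton, Sym2.eq_iff]; grind

/-- The matching condition at the vertices inside the square of the faces `A`, `B`, `C`, `D`,
where `A` is opposite to `D`. -/
def SquareCond (h : Face → ℤ) (M : Set (Sym2 Face)) (A B C D : Face) : Prop :=
  (h A = h D → h B = h C → ind M A B + ind M A C + ind M D B + ind M D C = 1) ∧
  (h A ≠ h D → ind M A B + ind M A C + ind M B C = 1 ∧ ind M D B + ind M D C + ind M B C = 1) ∧
  (h B ≠ h C → ind M B A + ind M B D + ind M A D = 1 ∧ ind M C A + ind M C D + ind M A D = 1)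

theorem SquareCond.reverse {h : Face → ℤ} {M : Set (Sym2 Face)} {A B C D : Face}
    (H : SquareCond h M A B C D) : SquareCond h M D C B A := by
  obtain ⟨h1, h2, h3⟩ := H
  refine ⟨fun ha hb => ?_, fun ha => ?_, fun ha => ?_⟩
  · linarith [h1 ha.symm hb.symm]
  · rw [ind_comm M C B]
    constructor <;> linarith [(h2 ha.symm).1, (h2 ha.symm).2]
  · rw [ind_comm M D A]
    constructor <;> linarith [(h3 ha.symm).1, (h3 ha.symm).2]

/-- By this symmetry any corner of a square can play the role of `A`. -/
theorem SquareCond.rotate {h : Face → ℤ} {M : Set (Sym2 Face)} {A B C D : Face}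
    (H : SquareCond h M A B C D) : SquareCond h M B D A C := by
  obtain ⟨h1, h2, h3⟩ := H
  have e1 := ind_comm M A B
  have e2 := ind_comm M A C
  have e3 := ind_comm M A D
  have e4 := ind_comm M B D
  have e5 := ind_comm M C D
  refine ⟨fun ha hb => ?_, fun ha => ?_, fun ha => ?_⟩
  · linarith [h1 hb.symm ha]
  · constructor <;> linarith [(h3 ha).1, (h3 ha).2]
  · have e6 := ind_comm M B C
    constructor <;> linarith [(h2 ha.symm).1, (h2 ha.symm).2]

/-- The left side lists every unit square once for each of its corners; invariance under rotation
makes one of the four enough. -/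
theorem forall_square_iff {Q : Face → Face → Face → Face → Prop}
    (hQ : ∀ {A B C D}, Q A B C D → Q B D A C) :
    (∀ q k, Q q (q + dir k) (q + dir (k + 1)) (q + dir k + dir (k + 1))) ↔
      ∀ i j : ℤ, Q (i, j) (i + 1, j) (i, j + 1) (i + 1, j + 1) := by
  constructor
  · intro H i j
    simpa [dir] using H (i, j) 0
  · rintro H ⟨i, j⟩ k
    fin_cases k
    · simpa [dir] using H i j
    · simpa [dir, add_comm, sub_eq_add_neg] using hQ (H (i - 1) j)
    · simpa [dir, add_comm, sub_eq_add_neg] using hQ (hQ (H (i - 1) (j - 1)))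
    · simpa [dir, add_comm, sub_eq_add_neg] using hQ (hQ (hQ (H i (j - 1))))

theorem IsPseudoHeightFunction.dir_eq {h : Face → ℤ} (hh : IsPseudoHeightFunction h) (q : Face)
    (k : Fin 4) : h (q + dir k) = h q + 1 ∨ h (q + dir k) = h q - 1 := by
  have := hh.step q (q + dir k) (latticeAdjacent_iff.2 ⟨k, rfl⟩)
  rcases abs_eq (zero_le_one' ℤ) |>.1 this with h | h <;> omega

theorem isMatchingOf_iff {h : Face → ℤ} {M : Set (Sym2 Face)} :
    IsMatchingOf (graphVertices h) (graphEdges h) M ↔ M ⊆ graphEdges h ∧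
      ∀ q k, SquareCond h M q (q + dir k) (q + dir (k + 1)) (q + dir k + dir (k + 1)) := by
  refine and_congr_right fun hM => ?_
  rw [forall_square_iff (Q := SquareCond h M) SquareCond.rotate]
  have hM' : ∀ p, s(p, p) ∉ M := fun p hp => not_borders_self h p (mem_graphEdges.1 (hM hp))
  have hd : ∀ i j : ℤ, h (i + 1, j) = h (i, j + 1) → s((i, j), (i + 1, j + 1)) ∉ M := by
    intro i j he hm
    have := mem_graphEdges.1 (hM hm)
    simp [Borders, LatticeAdjacent, he] at this
  have hd' : ∀ i j : ℤ, h (i, j) = h (i + 1, j + 1) → s((i + 1, j), (i, j + 1)) ∉ M := by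
    intro i j he hm
    have := mem_graphEdges.1 (hM hm)
    simp [Borders, LatticeAdjacent, he] at this
  constructor
  · intro H i j
    refine ⟨fun h1 h2 => ?_, fun h1 => ⟨?_, ?_⟩, fun h1 => ⟨?_, ?_⟩⟩
    · rw [← existsUnique_endsAt_quadruple hM' (by simp) (by simp) (by simp) (by simp) (by simp)
        (by simp) (hd i j h2) (hd' i j h1)]
      exact H _ ⟨i, j, Or.inl ⟨h1, h2, rfl⟩⟩
    · rw [← existsUnique_endsAt_triple hM' (by simp) (by simp) (by simp)]
      exact H _ ⟨i, j, Or.inr (Or.inl ⟨h1, Or.inl rfl⟩)⟩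
    · rw [← existsUnique_endsAt_triple hM' (by simp) (by simp) (by simp)]
      exact H _ ⟨i, j, Or.inr (Or.inl ⟨h1, Or.inr rfl⟩)⟩
    · rw [← existsUnique_endsAt_triple hM' (by simp) (by simp) (by simp)]
      exact H _ ⟨i, j, Or.inr (Or.inr ⟨h1, Or.inl rfl⟩)⟩
    · rw [← existsUnique_endsAt_triple hM' (by simp) (by simp) (by simp)]
      exact H _ ⟨i, j, Or.inr (Or.inr ⟨h1, Or.inr rfl⟩)⟩
  · rintro H v ⟨i, j, ⟨h1, h2, rfl⟩ | ⟨h1, rfl | rfl⟩ | ⟨h1, rfl | rfl⟩⟩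
    · rw [existsUnique_endsAt_quadruple hM' (by simp) (by simp) (by simp) (by simp) (by simp)
        (by simp) (hd i j h2) (hd' i j h1)]
      exact (H i j).1 h1 h2
    · rw [existsUnique_endsAt_triple hM' (by simp) (by simp) (by simp)]
      exact ((H i j).2.1 h1).1
    · rw [existsUnique_endsAt_triple hM' (by simp) (by simp) (by simp)]
      exact ((H i j).2.1 h1).2
    · rw [existsUnique_endsAt_triple hM' (by simp) (by simp) (by simp)]
      exact ((H i j).2.2 h1).1
    · rw [existsUnique_endsAt_triple hM' (by simp) (by simp) (by simp)]
      exact ((H i j).2.2 h1).2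

/-! ### Face exponents as integer expressions. -/

theorem ceil_intCast_div_two (x : ℤ) : ⌈(x : ℚ) / 2⌉ = (x + 1) / 2 := by
  rw [Int.ceil_eq_iff]
  have h : x ≤ 2 * ((x + 1) / 2) ∧ 2 * ((x + 1) / 2) ≤ x + 1 := by omega
  obtain ⟨h1, h2⟩ := h
  have h1' : (x : ℚ) ≤ 2 * ((x + 1) / 2 : ℤ) := by exact_mod_cast h1
  have h2' : 2 * (((x + 1) / 2 : ℤ) : ℚ) ≤ x + 1 := by exact_mod_cast h2
  constructor <;> linarith

/-- The number of edges of the face `p` outside of `M` minus the number of those in `M`. -/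
noncomputable def balance (h : Face → ℤ) (M : Set (Sym2 Face)) (p : Face) : ℤ :=
  ∑ k, (1 - 2 * ind M p (p + dir k)) +
    ∑ k, if h (p + dir k) ≠ h (p + dir (k + 1)) then
      1 - 2 * ind M p (p + dir k + dir (k + 1)) else 0

open Classical in
theorem ncard_diff_sub_ncard_inter {α : Type*} (F : Finset α) (M : Set α) :
    (((F : Set α) \ M).ncard : ℤ) - ((F : Set α) ∩ M).ncard =
      ∑ e ∈ F, (1 - 2 * if e ∈ M then (1 : ℤ) else 0) := by
  have h1 : (F : Set α) \ M = (F.filter (fun e => e ∉ M) : Finset α) := by ext; simp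
  have h2 : (F : Set α) ∩ M = (F.filter (fun e => e ∈ M) : Finset α) := by ext; simp
  rw [h1, h2, Set.ncard_coe_finset, Set.ncard_coe_finset, Finset.sum_sub_distrib,
    ← Finset.mul_sum, Finset.sum_boole]
  have := Finset.card_filter_add_card_filter_not (s := F) (fun e => e ∈ M)
  simp
  omega

/-- The edges of `p` correspond to offsets: the four unit vectors always, and a diagonal vector
whenever a middle edge borders `p` there. These offsets are distinct, so the count becomes a sum
over directions. The integer division rounds down. -/
theorem faceExponent_eq (h : Face → ℤ) (M : Set (Sym2 Face)) (p : Face) :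
    faceExponent h M p = (balance h M p + 1) / 2 - 1 := by
  classical
  have hF : faceEdges h p = ((Finset.univ.image (fun k => s(p, p + dir k)) ∪
      (Finset.univ.filter (fun k => h (p + dir k) ≠ h (p + dir (k + 1)))).image
        (fun k => s(p, p + dir k + dir (k + 1))) : Finset (Sym2 Face)) : Set (Sym2 Face)) := by
    ext e
    simp only [faceEdges, Set.mem_ofPred_eq, Finset.coe_union, Finset.coe_image, Set.mem_union,
      Set.mem_image, Finset.coe_univ, Set.mem_univ, true_and, Finset.coe_filter, Finset.mem_univ]
    constructor
    · rintro ⟨he, hp⟩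
      obtain ⟨q, rfl⟩ := Sym2.mem_iff_exists.1 hp
      rcases borders_iff.1 (mem_graphEdges.1 he) with ⟨k, rfl⟩ | ⟨k, rfl, hk⟩
      exacts [Or.inl ⟨k, rfl⟩, Or.inr ⟨k, hk, rfl⟩]
    · rintro (⟨k, rfl⟩ | ⟨k, hk, rfl⟩)
      exacts [⟨graphEdges_lattice h p k, by simp⟩, ⟨graphEdges_diagonal.2 hk, by simp⟩]
  have hdiag : ∀ k l : Fin 4, dir k + dir (k + 1) = dir l + dir (l + 1) → k = l := by decide
  have hcross : ∀ k l : Fin 4, dir k ≠ dir l + dir (l + 1) := by decide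
  have key : ((faceEdges h p \ M).ncard : ℤ) - (faceEdges h p ∩ M).ncard = balance h M p := by
    rw [hF, ncard_diff_sub_ncard_inter, Finset.sum_union, Finset.sum_image, Finset.sum_image,
      Finset.sum_filter]
    · rfl
    · intro k _ l _ hkl
      simp only [Sym2.congr_right, add_assoc, add_right_inj] at hkl
      exact hdiag k l hkl
    · intro k _ l _ hkl
      simp only [Sym2.congr_right, add_right_inj] at hkl
      exact dir_injective hkl
    · rw [Finset.disjoint_left]
      intro e he he'
      simp only [Finset.mem_image, Finset.mem_filter, Finset.mem_univ, true_and] at he he'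
      obtain ⟨k, rfl⟩ := he
      obtain ⟨l, -, hl⟩ := he'
      simp only [Sym2.congr_right, add_assoc, add_right_inj] at hl
      exact hcross k l hl.symm
  rw [faceExponent, ← ceil_intCast_div_two, ← key]
  push_cast
  rfl

theorem not_mem_unweightedEdges_lattice (h : Face → ℤ) (p : Face) (k : Fin 4) :
    s(p, p + dir k) ∉ unweightedEdges h := by
  rintro ⟨-, a, b, hab, hn⟩
  rcases Sym2.eq_iff.1 hab with ⟨rfl, rfl⟩ | ⟨rfl, rfl⟩
  · exact hn (latticeAdjacent_iff.2 ⟨k, rfl⟩)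
  · exact hn (latticeAdjacent_comm.1 (latticeAdjacent_iff.2 ⟨k, rfl⟩))

theorem mem_unweightedEdges_diagonal {h : Face → ℤ} {p : Face} {k : Fin 4} :
    s(p, p + dir k + dir (k + 1)) ∈ unweightedEdges h ↔ h (p + dir k) ≠ h (p + dir (k + 1)) := by
  rw [← graphEdges_diagonal]
  exact ⟨fun H => H.1, fun H => ⟨H, _, _, rfl, not_latticeAdjacent_diagonal p k⟩⟩

/-- The second diagonal of a square is the first one as seen from the corner `p + dir k`. -/
theorem antidiagonal_eq (p : Face) (k : Fin 4) :
    p + dir (k + 1) = p + dir k + dir (k + 1) + dir (k + 1 + 1) := by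
  rw [add_assoc k, show (1 : Fin 4) + 1 = 2 from rfl, dir_add_two]
  abel

theorem mem_graphEdges_antidiagonal {h : Face → ℤ} {p : Face} {k : Fin 4} :
    s(p + dir k, p + dir (k + 1)) ∈ graphEdges h ↔ h p ≠ h (p + dir k + dir (k + 1)) := by
  have h2 : p = p + dir k + dir (k + 1 + 1) := by
    rw [add_assoc k, show (1 : Fin 4) + 1 = 2 from rfl, dir_add_two]
    abel
  rw [antidiagonal_eq p k, graphEdges_diagonal, ← h2, ne_comm]

theorem mem_unweightedEdges_antidiagonal {h : Face → ℤ} {p : Face} {k : Fin 4} :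
    s(p + dir k, p + dir (k + 1)) ∈ unweightedEdges h ↔ h p ≠ h (p + dir k + dir (k + 1)) := by
  have h2 : p = p + dir k + dir (k + 1 + 1) := by
    rw [add_assoc k, show (1 : Fin 4) + 1 = 2 from rfl, dir_add_two]
    abel
  rw [antidiagonal_eq p k, mem_unweightedEdges_diagonal, ← h2, ne_comm]

/-! ### The cone function and the rigidity of matchings on it. -/

section Cone

variable {P : ℤ × ℤ × ℤ}

theorem coneFun_dir (q : Face) (k : Fin 4) :
    coneFun P (q + dir k) = coneFun P q + 1 ∨ coneFun P (q + dir k) = coneFun P q - 1 := by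
  fin_cases k <;> simp [coneFun, dir] <;> grind

/-- The cone function is a function of `i` plus a function of `j`, and `dir k` is perpendicular to
`dir (k + 1)`. -/
theorem coneFun_add_dir_add_dir (q : Face) (k : Fin 4) :
    coneFun P (q + dir k + dir (k + 1)) =
      coneFun P (q + dir k) + coneFun P (q + dir (k + 1)) - coneFun P q := by
  fin_cases k <;> simp [coneFun, dir] <;> ring

/-- Concavity along the axes: a step that leads away from the apex can be continued. -/
theorem coneFun_dir_dir {q : Face} {k : Fin 4} (h : coneFun P (q + dir k) = coneFun P q - 1) :
    coneFun P (q + dir k + dir k) = coneFun P q - 2 := by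
  fin_cases k <;> simp [coneFun, dir] at h ⊢ <;> grind

theorem coneFun_dir_add_coneFun_dir_add_two (q : Face) (k : Fin 4) :
    coneFun P (q + dir k) + coneFun P (q + dir (k + 2)) ≤ 2 * coneFun P q := by
  fin_cases k <;> simp [coneFun, dir] <;> grind

theorem eq_apex_iff {q : Face} : q = P.2 ↔ ∀ k, coneFun P (q + dir k) = coneFun P q - 1 := by
  obtain ⟨n, i, j⟩ := P
  obtain ⟨a, b⟩ := q
  simp only [Fin.forall_fin_succ, coneFun, dir, Prod.ext_iff]
  simp
  grind

theorem isPseudoHeightFunction_coneFun (hP : P ∈ octLattice) :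
    IsPseudoHeightFunction (coneFun P) where
  step p q hpq := by
    obtain ⟨k, rfl⟩ := latticeAdjacent_iff.1 hpq
    rcases coneFun_dir (P := P) p k with h | h <;> rw [h] <;> simp
  parity p := by
    simp only [octLattice, Set.mem_ofPred_eq, coneFun, Int.ModEq] at hP ⊢
    grind

/-- The two functions differ by an even number at every face, so they cannot change order between
neighbours without meeting. -/
theorem IsPseudoHeightFunction.min {g h : Face → ℤ} (hg : IsPseudoHeightFunction g)
    (hh : IsPseudoHeightFunction h) : IsPseudoHeightFunction (fun p => min (g p) (h p)) where
  step p q hpq := by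
    have h1 := hg.step p q hpq
    have h2 := hh.step p q hpq
    have h3 := hg.parity p
    have h4 := hh.parity p
    have h5 := hg.parity q
    have h6 := hh.parity q
    simp only [octLattice, Set.mem_ofPred_eq, Int.ModEq] at h3 h4 h5 h6
    grind
  parity p := by
    rcases min_choice (g p) (h p) with h' | h' <;> simp only [h']
    exacts [hg.parity p, hh.parity p]

/-- `M` is a matching of the graph of `g` that coincides with the middle edges of the graph of
the cone function for all but finitely many edges. -/
def ConeMatching (P : ℤ × ℤ × ℤ) (g : Face → ℤ) (M : Set (Sym2 Face)) : Prop :=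
  IsMatchingOf (graphVertices g) (graphEdges g) M ∧
    (symmDiff M (unweightedEdges (coneFun P))).Finite

/-- A step up would exceed the cone. Hence agreement with the cone spreads away from the apex. -/
theorem eq_coneFun_of_outward {g : Face → ℤ} (hg : IsPseudoHeightFunction g)
    (hle : ∀ q, g q ≤ coneFun P q) {A : Face} {k : Fin 4} (hA : g A = coneFun P A)
    (hB : coneFun P (A + dir k) = coneFun P A - 1) : g (A + dir k) = coneFun P (A + dir k) := by
  have h1 := hle (A + dir k)
  rcases hg.dir_eq A k with h | h <;> omega

/-- The rigidity argument. If the middle edge is missing, the outer vertex of the wrench is matched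
by an edge that also ends at the inner vertex of a square further out. The middle edge there is then
missing too, which cannot go on for ever since `M` is standard up to finitely many edges. -/
theorem middle_mem_of_outward {g : Face → ℤ} (hg : IsPseudoHeightFunction g)
    (hle : ∀ q, g q ≤ coneFun P q) {M : Set (Sym2 Face)} (hM : ConeMatching P g M) {A : Face}
    {k : Fin 4} (hA : g A = coneFun P A) (hB : coneFun P (A + dir k) = coneFun P A - 1)
    (hC : coneFun P (A + dir (k + 1)) = coneFun P A - 1) :
    s(A + dir k, A + dir (k + 1)) ∈ M := by
  set bad : Set Face := {A | g A = coneFun P A ∧ coneFun P (A + dir k) = coneFun P A - 1 ∧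
    coneFun P (A + dir (k + 1)) = coneFun P A - 1 ∧ s(A + dir k, A + dir (k + 1)) ∉ M} with hbad
  by_contra hcon
  have hne : bad.Nonempty := ⟨A, hA, hB, hC, hcon⟩
  clear hA hB hC hcon A
  -- Distinct bad corners miss distinct middle edges of the cone graph.
  have hfin : bad.Finite := by
    refine Set.Finite.of_finite_image (f := fun A => s(A + dir k, A + dir (k + 1)))
      (hM.2.subset ?_) ?_
    · rintro _ ⟨A, ⟨-, hB, hC, hn⟩, rfl⟩
      refine Or.inr ⟨mem_unweightedEdges_antidiagonal.2 ?_, hn⟩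
      rw [coneFun_add_dir_add_dir]
      omega
    · intro A _ A' _ h
      rcases Sym2.eq_iff.1 h with ⟨h1, -⟩ | ⟨h1, h2⟩
      · exact add_right_cancel h1
      · exfalso
        have h3 : (2 : ℤ) • dir k = (2 : ℤ) • dir (k + 1) := by
          have := congrArg₂ (· - ·) h1 h2
          simp only [add_sub_add_left_eq_sub] at this
          rw [two_smul, two_smul, ← sub_eq_zero]
          have h4 := sub_eq_zero.2 this
          rw [← h4]
          abel
        revert h3
        clear * - 
        revert k
        decide
  -- The least cone value singles out a bad square farthest from the apex.
  obtain ⟨A, ⟨hA, hB, hC, hn⟩, hmin⟩ := Set.exists_min_image bad (coneFun P) hfin hne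
  have hD := coneFun_add_dir_add_dir (P := P) A k
  have hgB := eq_coneFun_of_outward hg hle hA hB
  have hgC := eq_coneFun_of_outward hg hle hA hC
  have hgD : g (A + dir k + dir (k + 1)) = coneFun P (A + dir k + dir (k + 1)) :=
    eq_coneFun_of_outward hg hle hgB (by omega)
  have hcond := (isMatchingOf_iff.1 hM.1).2
  have hD0 := ((hcond A k).2.1 (by omega)).2
  rw [ind_eq_zero.2 hn, add_zero] at hD0
  -- The outer vertex of a bad square is matched into a bad square further out.
  have next : ∀ B, coneFun P B = coneFun P A - 1 → g B = coneFun P B →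
      coneFun P (B + dir k) = coneFun P B - 1 → coneFun P (B + dir (k + 1)) = coneFun P B - 1 →
      (s(B, B + dir k) ∈ M ∨ s(B, B + dir (k + 1)) ∈ M) → False := by
    intro B hBA hgB h1 h2 h3
    have h4 : B ∉ bad := fun hb => by have := hmin B hb; omega
    have h5 : s(B + dir k, B + dir (k + 1)) ∈ M := by
      by_contra hcon
      exact h4 ⟨hgB, h1, h2, hcon⟩
    have h6 := coneFun_add_dir_add_dir (P := P) B k
    have h7 := eq_coneFun_of_outward hg hle hgB h1
    have h8 : g (B + dir k + dir (k + 1)) = coneFun P (B + dir k + dir (k + 1)) :=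
      eq_coneFun_of_outward hg hle h7 (by omega)
    have h9 := ((hcond B k).2.1 (by omega)).1
    rw [ind_eq_one.2 h5] at h9
    have n1 := ind_nonneg M B (B + dir k)
    have n2 := ind_nonneg M B (B + dir (k + 1))
    rcases h3 with h3 | h3 <;> rw [ind_eq_one.2 h3] at h9 <;> omega
  have hBB := coneFun_dir_dir hB
  have hCC := coneFun_dir_dir hC
  have hDC : A + dir (k + 1) + dir k = A + dir k + dir (k + 1) := by abel
  rcases (by
    have n1 := ind_nonneg M (A + dir k + dir (k + 1)) (A + dir k)
    have n2 := ind_nonneg M (A + dir k + dir (k + 1)) (A + dir (k + 1))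
    omega : ind M (A + dir k + dir (k + 1)) (A + dir k) = 1 ∨
      ind M (A + dir k + dir (k + 1)) (A + dir (k + 1)) = 1) with h | h
  · rw [ind_comm, ind_eq_one] at h
    exact next (A + dir k) hB hgB (by omega) (by omega) (Or.inr h)
  · rw [ind_comm, ind_eq_one, ← hDC] at h
    exact next (A + dir (k + 1)) hC hgC (by rw [hDC]; omega) (by omega) (Or.inl h)

/-- The cone function differs on exactly one diagonal of every square, so its graph has wrenches
only. -/
theorem coneFun_ne_iff (q : Face) (k : Fin 4) :
    coneFun P q ≠ coneFun P (q + dir k + dir (k + 1)) ↔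
      coneFun P (q + dir k) = coneFun P (q + dir (k + 1)) := by
  have h1 := coneFun_add_dir_add_dir (P := P) q k
  rcases coneFun_dir (P := P) q k with h2 | h2 <;>
    rcases coneFun_dir (P := P) q (k + 1) with h3 | h3 <;> omega

/-- The four sign cases tell which corner of the square is closest to the apex;
`middle_mem_of_outward` is applied from that corner. -/
theorem middle_mem {g : Face → ℤ} (hg : IsPseudoHeightFunction g)
    (hle : ∀ q, g q ≤ coneFun P q) {M : Set (Sym2 Face)} (hM : ConeMatching P g M) {q : Face}
    {k : Fin 4} (hA : g q = coneFun P q) (hB : g (q + dir k) = coneFun P (q + dir k))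
    (hC : g (q + dir (k + 1)) = coneFun P (q + dir (k + 1)))
    (hD : g (q + dir k + dir (k + 1)) = coneFun P (q + dir k + dir (k + 1))) :
    (coneFun P q ≠ coneFun P (q + dir k + dir (k + 1)) → s(q + dir k, q + dir (k + 1)) ∈ M) ∧
    (coneFun P (q + dir k) ≠ coneFun P (q + dir (k + 1)) →
      s(q, q + dir k + dir (k + 1)) ∈ M) := by
  have h1 := coneFun_add_dir_add_dir (P := P) q k
  have e2 : k + 1 + 1 = k + 2 := by rw [add_assoc]; rfl
  have e3 : k + 2 + 1 = k + 3 := by rw [add_assoc]; rfl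
  have e4 : k + 3 + 1 = k := by rw [add_assoc]; exact add_zero k
  have d2 := dir_add_two k
  have d3 : dir (k + 3) = -dir (k + 1) := by
    rw [← dir_add_two, add_assoc]; rfl
  rcases coneFun_dir (P := P) q k with h2 | h2 <;>
    rcases coneFun_dir (P := P) q (k + 1) with h3 | h3
  · refine ⟨fun _ => ?_, fun h => by omega⟩
    have a1 : q + dir k + dir (k + 1) + dir (k + 2) = q + dir (k + 1) := by rw [d2]; abel
    have a2 : q + dir k + dir (k + 1) + dir (k + 2 + 1) = q + dir k := by rw [e3, d3]; abel
    have := middle_mem_of_outward hg hle hM (k := k + 2) hD (by rw [a1]; omega) (by rw [a2]; omega)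
    rwa [a1, a2, Sym2.eq_swap] at this
  · refine ⟨fun h => by omega, fun _ => ?_⟩
    have a2 : q + dir k + dir (k + 1 + 1) = q := by rw [e2, d2]; abel
    have := middle_mem_of_outward hg hle hM (k := k + 1) hB (by omega) (by rw [a2]; omega)
    rwa [a2, Sym2.eq_swap] at this
  · refine ⟨fun h => by omega, fun _ => ?_⟩
    have a1 : q + dir (k + 1) + dir (k + 3) = q := by rw [d3]; abel
    have a2 : q + dir (k + 1) + dir (k + 3 + 1) = q + dir k + dir (k + 1) := by rw [e4]; abel
    have := middle_mem_of_outward hg hle hM (k := k + 3) hC (by rw [a1]; omega) (by rw [a2]; omega)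
    rwa [a1, a2] at this
  · exact ⟨fun _ => middle_mem_of_outward hg hle hM hA h2 h3, fun h => by omega⟩

theorem squareCond_congr {g g' : Face → ℤ} {M M' : Set (Sym2 Face)} {A B C D : Face}
    (hA : g A = g' A) (hB : g B = g' B) (hC : g C = g' C) (hD : g D = g' D)
    (hAB : s(A, B) ∈ M ↔ s(A, B) ∈ M') (hAC : s(A, C) ∈ M ↔ s(A, C) ∈ M')
    (hAD : s(A, D) ∈ M ↔ s(A, D) ∈ M') (hBC : s(B, C) ∈ M ↔ s(B, C) ∈ M')
    (hBD : s(B, D) ∈ M ↔ s(B, D) ∈ M') (hCD : s(C, D) ∈ M ↔ s(C, D) ∈ M') :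
    SquareCond g M A B C D ↔ SquareCond g' M' A B C D := by
  simp only [SquareCond, hA, hB, hC, hD, ind_comm M B A, ind_comm M' B A, ind_comm M C A,
    ind_comm M' C A, ind_comm M D B, ind_comm M' D B, ind_comm M D C, ind_comm M' D C,
    ind_congr hAB, ind_congr hAC, ind_congr hAD, ind_congr hBC, ind_congr hBD, ind_congr hCD]

theorem coneMatching_unweightedEdges : ConeMatching P (coneFun P) (unweightedEdges (coneFun P)) := by
  refine ⟨isMatchingOf_iff.2 ⟨fun e he => he.1, fun q k => ?_⟩, by simp⟩
  have l1 := not_mem_unweightedEdges_lattice (coneFun P) q k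
  have l2 := not_mem_unweightedEdges_lattice (coneFun P) q (k + 1)
  have l3 := not_mem_unweightedEdges_lattice (coneFun P) (q + dir k) (k + 1)
  have l4 := not_mem_unweightedEdges_lattice (coneFun P) (q + dir (k + 1)) k
  rw [add_right_comm] at l4
  have h1 := mem_unweightedEdges_diagonal (h := coneFun P) (p := q) (k := k)
  have h2 := mem_unweightedEdges_antidiagonal (h := coneFun P) (p := q) (k := k)
  have h3 := coneFun_ne_iff (P := P) q k
  rw [← ind_eq_zero] at l1 l2 l3 l4
  have l3' := (ind_comm _ _ _).trans l3
  have l4' := (ind_comm _ _ _).trans l4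
  have l1' := (ind_comm _ _ _).trans l1
  have l2' := (ind_comm _ _ _).trans l2
  refine ⟨fun ha hb => absurd ha (h3.2 hb), fun ha => ?_, fun hb => ?_⟩
  · rw [l1, l2, l3', l4', ind_eq_one.2 (h2.2 ha)]
    simp
  · rw [l1', l2', l3, l4, ind_eq_one.2 (h1.2 hb)]
    simp

/-- On a square on which `g` is the cone function, all matchings coincide. -/
theorem mem_iff_of_square {g : Face → ℤ} (hg : IsPseudoHeightFunction g)
    (hle : ∀ q, g q ≤ coneFun P q) {M : Set (Sym2 Face)} (hM : ConeMatching P g M) {q : Face}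
    {k : Fin 4} (hA : g q = coneFun P q) (hB : g (q + dir k) = coneFun P (q + dir k))
    (hC : g (q + dir (k + 1)) = coneFun P (q + dir (k + 1)))
    (hD : g (q + dir k + dir (k + 1)) = coneFun P (q + dir k + dir (k + 1))) :
    (s(q, q + dir k) ∉ M ∧ s(q, q + dir (k + 1)) ∉ M ∧
      s(q + dir k, q + dir k + dir (k + 1)) ∉ M ∧
      s(q + dir (k + 1), q + dir k + dir (k + 1)) ∉ M) ∧
    (s(q, q + dir k + dir (k + 1)) ∈ M ↔
      s(q, q + dir k + dir (k + 1)) ∈ unweightedEdges (coneFun P)) ∧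
    (s(q + dir k, q + dir (k + 1)) ∈ M ↔
      s(q + dir k, q + dir (k + 1)) ∈ unweightedEdges (coneFun P)) := by
  have h1 := middle_mem hg hle hM hA hB hC hD
  have hsub := (isMatchingOf_iff.1 hM.1).1
  have hcond := (isMatchingOf_iff.1 hM.1).2 q k
  rw [mem_unweightedEdges_antidiagonal, mem_unweightedEdges_diagonal]
  refine ⟨?_, ⟨fun h => ?_, h1.2⟩, ⟨fun h => ?_, h1.1⟩⟩
  -- The middle edge already covers both vertices of the wrench, which leaves no room for the four
  -- other edges.
  · have i1 := ind_nonneg M q (q + dir k)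
    have i2 := ind_nonneg M q (q + dir (k + 1))
    have i3 := ind_nonneg M (q + dir k) (q + dir k + dir (k + 1))
    have i4 := ind_nonneg M (q + dir (k + 1)) (q + dir k + dir (k + 1))
    have j1 := ind_comm M q (q + dir k)
    have j2 := ind_comm M q (q + dir (k + 1))
    have j3 := ind_comm M (q + dir k) (q + dir k + dir (k + 1))
    have j4 := ind_comm M (q + dir (k + 1)) (q + dir k + dir (k + 1))
    simp only [← ind_eq_zero]
    by_cases hd : coneFun P q = coneFun P (q + dir k + dir (k + 1))
    · have hd' : coneFun P (q + dir k) ≠ coneFun P (q + dir (k + 1)) :=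
        fun h => (coneFun_ne_iff q k).2 h hd
      have m1 := ind_eq_one.2 (h1.2 hd')
      have m2 := hcond.2.2 (by rw [hB, hC]; exact hd')
      refine ⟨?_, ?_, ?_, ?_⟩ <;> linarith [m2.1, m2.2]
    · have m1 := ind_eq_one.2 (h1.1 hd)
      have m2 := hcond.2.1 (by rw [hA, hD]; exact hd)
      refine ⟨?_, ?_, ?_, ?_⟩ <;> linarith [m2.1, m2.2]
  · rw [← hB, ← hC]
    exact graphEdges_diagonal.1 (hsub h)
  · rw [← hA, ← hD]
    exact mem_graphEdges_antidiagonal.1 (hsub h)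

end Cone

/-! ### Finiteness, and the sum for the cone function itself. -/

section Cone

variable {P : ℤ × ℤ × ℤ}

/-- `g` is the cone function at `q` and at the eight faces around `q`. -/
def AgreesAround (P : ℤ × ℤ × ℤ) (g : Face → ℤ) (q : Face) : Prop :=
  g q = coneFun P q ∧ (∀ k, g (q + dir k) = coneFun P (q + dir k)) ∧
    ∀ k, g (q + dir k + dir (k + 1)) = coneFun P (q + dir k + dir (k + 1))

theorem finite_not_agreesAround {g : Face → ℤ} (hfin : {q | g q ≠ coneFun P q}.Finite) :
    {q | ¬ AgreesAround P g q}.Finite := by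
  have h1 : ∀ v : Face, {q | g (q + v) ≠ coneFun P (q + v)}.Finite := fun v =>
    hfin.preimage (f := fun q => q + v) (add_left_injective v).injOn
  refine (((h1 0).union (Set.finite_iUnion fun k => h1 (dir k))).union
    (Set.finite_iUnion fun k => h1 (dir k + dir (k + 1)))).subset ?_
  intro q hq
  by_contra hcon
  simp only [Set.mem_union, Set.mem_iUnion, Set.mem_ofPred_eq, add_zero, not_or, not_exists,
    not_not, ← add_assoc] at hcon
  exact hq ⟨hcon.1.1, hcon.1.2, hcon.2⟩

theorem mem_iff_of_agreesAround {g : Face → ℤ} (hg : IsPseudoHeightFunction g)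
    (hle : ∀ q, g q ≤ coneFun P q) {M : Set (Sym2 Face)} (hM : ConeMatching P g M) {q : Face}
    (hq : AgreesAround P g q) {e : Sym2 Face} (he : q ∈ e) :
    e ∈ M ↔ e ∈ unweightedEdges (coneFun P) := by
  obtain ⟨r, rfl⟩ := Sym2.mem_iff_exists.1 he
  have key := fun k => mem_iff_of_square hg hle hM hq.1 (hq.2.1 k) (hq.2.1 (k + 1)) (hq.2.2 k)
  by_cases h1 : ∃ k, r = q + dir k
  · obtain ⟨k, rfl⟩ := h1
    exact iff_of_false (key k).1.1 (not_mem_unweightedEdges_lattice _ _ _)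
  by_cases h2 : ∃ k, r = q + dir k + dir (k + 1)
  · obtain ⟨k, rfl⟩ := h2
    exact (key k).2.1
  have h3 : ∀ h : Face → ℤ, s(q, r) ∉ graphEdges h := by
    intro h hmem
    rcases borders_iff.1 (mem_graphEdges.1 hmem) with h | ⟨k, hk, -⟩
    exacts [h1 h, h2 ⟨k, hk⟩]
  exact iff_of_false (fun h => h3 _ (hM.1.1 h)) (fun h => h3 _ h.1)

/-- The edges at a face with `AgreesAround` are forced, so a matching is determined by its trace on
the finite set `F` of the remaining edges. -/
theorem finite_setOf_coneMatching {g : Face → ℤ} (hg : IsPseudoHeightFunction g)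
    (hle : ∀ q, g q ≤ coneFun P q) (hfin : {q | g q ≠ coneFun P q}.Finite) :
    {M | ConeMatching P g M}.Finite := by
  set F : Set (Sym2 Face) := {e | e ∈ graphEdges g ∧ ∀ q ∈ e, ¬ AgreesAround P g q} with hF
  have hFfin : F.Finite := by
    have h1 := finite_not_agreesAround hfin
    refine ((h1.prod h1).image (fun x : Face × Face => s(x.1, x.2))).subset ?_
    rintro e ⟨-, he⟩
    induction e with | _ a b
    exact ⟨(a, b), ⟨he a (by simp), he b (by simp)⟩, rfl⟩
  refine Set.Finite.of_finite_image (f := fun M => M ∩ F)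
    (hFfin.powerset.subset ?_) ?_
  · rintro _ ⟨M, -, rfl⟩
    exact Set.inter_subset_right
  · intro M hM M' hM' h
    ext e
    by_cases he : ∃ q ∈ e, AgreesAround P g q
    · obtain ⟨q, hqe, hq⟩ := he
      rw [mem_iff_of_agreesAround hg hle hM hq hqe, mem_iff_of_agreesAround hg hle hM' hq hqe]
    · push Not at he
      have h1 : e ∈ M ∩ F ↔ e ∈ M' ∩ F := by
        have : M ∩ F = M' ∩ F := h
        rw [this]
      constructor
      · exact fun hm => (h1.1 ⟨hm, hM.1.1 hm, he⟩).1
      · exact fun hm => (h1.2 ⟨hm, hM'.1.1 hm, he⟩).1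

theorem orientedWeight_eq_one {h : Face → ℤ} {p q : Face} (hpq : ¬ LatticeAdjacent p q) :
    orientedWeight h p q = 1 := by
  rw [orientedWeight, if_neg, if_neg]
  · rintro rfl
    exact hpq (latticeAdjacent_iff.2 ⟨1, by simp [dir, Prod.ext_iff]⟩)
  · rintro rfl
    exact hpq (latticeAdjacent_iff.2 ⟨0, by simp [dir, Prod.ext_iff]⟩)

theorem edgeWeight_eq_one {h : Face → ℤ} {p q : Face} (hpq : ¬ LatticeAdjacent p q) :
    edgeWeight h s(p, q) = 1 := by
  rw [edgeWeight, Sym2.lift_mk]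
  simp only
  rw [orientedWeight_eq_one hpq, orientedWeight_eq_one (mt latticeAdjacent_comm.1 hpq), mul_one]

theorem edgeWeight_eq_one_of_mem {h h' : Face → ℤ} {e : Sym2 Face} (he : e ∈ unweightedEdges h) :
    edgeWeight h' e = 1 := by
  obtain ⟨-, p, q, rfl, hpq⟩ := he
  exact edgeWeight_eq_one hpq

theorem ConeMatching.finite_edgeWeight_ne_one {g : Face → ℤ} {M : Set (Sym2 Face)}
    (hM : ConeMatching P g M) (g' : Face → ℤ) : {e | e ∈ M ∧ edgeWeight g' e ≠ 1}.Finite := by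
  refine hM.2.subset ?_
  rintro e ⟨he, hw⟩
  exact Or.inl ⟨he, fun h => hw (edgeWeight_eq_one_of_mem h)⟩

theorem balance_coneFun (q : Face) :
    balance (coneFun P) (unweightedEdges (coneFun P)) q =
      4 - ∑ k, if coneFun P (q + dir k) ≠ coneFun P (q + dir (k + 1)) then 1 else 0 := by
  rw [balance, sub_eq_add_neg, ← Finset.sum_neg_distrib]
  congr 1
  · rw [Finset.sum_congr rfl fun k _ => by
      rw [ind_eq_zero.2 (not_mem_unweightedEdges_lattice _ q k)]]
    rfl
  · refine Finset.sum_congr rfl fun k _ => ?_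
    split_ifs with h
    · rw [ind_eq_one.2 (mem_unweightedEdges_diagonal.2 h)]
      rfl
    · rfl

/-- Around a face other than the apex the four steps switch between up and down exactly twice, so
the face is a hexagon with two matched edges. At the apex all steps go down, and the face is a
quadrilateral without matched edges. -/
theorem faceExponent_coneFun (q : Face) :
    faceExponent (coneFun P) (unweightedEdges (coneFun P)) q = if q = P.2 then 1 else 0 := by
  rw [faceExponent_eq, balance_coneFun, Fin.sum_univ_four]
  have h0 := coneFun_dir (P := P) q 0
  have h1 := coneFun_dir (P := P) q 1
  have h2 := coneFun_dir (P := P) q 2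
  have h3 := coneFun_dir (P := P) q 3
  have h4 := coneFun_dir_add_coneFun_dir_add_two (P := P) q 0
  have h5 := coneFun_dir_add_coneFun_dir_add_two (P := P) q 1
  have h6 := eq_apex_iff (P := P) (q := q)
  simp only [Fin.isValue, zero_add, show (1 : Fin 4) + 1 = 2 from rfl,
    show (1 : Fin 4) + 2 = 3 from rfl, show (2 : Fin 4) + 1 = 3 from rfl,
    show (3 : Fin 4) + 1 = 0 from rfl] at h4 h5 ⊢
  by_cases hq : q = P.2
  · rw [if_pos hq]
    have h := h6.1 hq
    simp [h]
  · rw [if_neg hq]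
    have h : ¬ (coneFun P (q + dir 0) = coneFun P q - 1 ∧ coneFun P (q + dir 1) = coneFun P q - 1 ∧
        coneFun P (q + dir 2) = coneFun P q - 1 ∧ coneFun P (q + dir 3) = coneFun P q - 1) := by
      rintro ⟨a0, a1, a2, a3⟩
      refine hq (h6.2 fun k => ?_)
      fin_cases k
      exacts [a0, a1, a2, a3]
    split_ifs <;> omega

theorem faceExponent_of_agreesAround {g : Face → ℤ} (hg : IsPseudoHeightFunction g)
    (hle : ∀ q, g q ≤ coneFun P q) {M : Set (Sym2 Face)} (hM : ConeMatching P g M) {q : Face}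
    (hq : AgreesAround P g q) : faceExponent g M q = if q = P.2 then 1 else 0 := by
  have h1 : balance g M q = balance (coneFun P) (unweightedEdges (coneFun P)) q := by
    have key : ∀ r, ind M q r = ind (unweightedEdges (coneFun P)) q r := fun r =>
      ind_congr (mem_iff_of_agreesAround hg hle hM hq (by simp))
    simp only [balance, key, hq.2.1]
  rw [← faceExponent_coneFun, faceExponent_eq, faceExponent_eq, h1]

theorem finite_faceExponent_ne_zero {g : Face → ℤ} (hg : IsPseudoHeightFunction g)
    (hle : ∀ q, g q ≤ coneFun P q) (hfin : {q | g q ≠ coneFun P q}.Finite)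
    {M : Set (Sym2 Face)} (hM : ConeMatching P g M) : {q | faceExponent g M q ≠ 0}.Finite := by
  refine ((finite_not_agreesAround hfin).union (Set.finite_singleton P.2)).subset ?_
  intro q hq
  by_contra hcon
  simp only [Set.mem_union, Set.mem_ofPred_eq, Set.mem_singleton_iff, not_or, not_not] at hcon
  exact hq (by rw [faceExponent_of_agreesAround hg hle hM hcon.1, if_neg hcon.2])

/-- The matching monomial with the values `y n p` of the points `(n, p)` in place of the face
variables. -/
noncomputable def heightMonomial (y : ℤ → Face → OctField) (g : Face → ℤ)
    (M : Set (Sym2 Face)) : OctField :=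
  (∏ᶠ e ∈ M, edgeWeight g e) * ∏ᶠ p : Face, y (g p) p ^ faceExponent g M p

theorem coneMatching_coneFun_iff (hP : P ∈ octLattice) {M : Set (Sym2 Face)} :
    ConeMatching P (coneFun P) M ↔ M = unweightedEdges (coneFun P) := by
  refine ⟨fun hM => ?_, by rintro rfl; exact coneMatching_unweightedEdges⟩
  ext e
  induction e with | _ a b
  exact mem_iff_of_agreesAround (isPseudoHeightFunction_coneFun hP) (fun _ => le_rfl) hM
    (q := a) ⟨rfl, fun _ => rfl, fun _ => rfl⟩ (by simp)

theorem finsum_heightMonomial_coneFun (hP : P ∈ octLattice) (y : ℤ → Face → OctField) :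
    ∑ᶠ M ∈ {M | ConeMatching P (coneFun P) M}, heightMonomial y (coneFun P) M = y P.1 P.2 := by
  simp only [Set.mem_ofPred_eq, coneMatching_coneFun_iff hP]
  rw [finsum_eq_single _ (unweightedEdges (coneFun P))]
  · simp only [finsum_true, heightMonomial]
    rw [finprod_mem_of_eqOn_one fun e he => edgeWeight_eq_one_of_mem he, one_mul,
      finprod_eq_single _ P.2]
    · simp [faceExponent_coneFun, coneFun]
    · intro q hq
      rw [faceExponent_coneFun, if_neg hq, zpow_zero]
  · intro M hM
    simp [hM]

end Cone

/-! ### Changing the function at a single face `q`. -/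

theorem dir_add_three (k : Fin 4) : dir (k + 3) = -dir (k + 1) := by revert k; decide

/-- The four edges of the face `q` to its lattice neighbours, and the four possible middle edges
between these neighbours. -/
def localEdges (q : Face) : Set (Sym2 Face) :=
  Set.range (fun k => s(q, q + dir k)) ∪ Set.range (fun k => s(q + dir k, q + dir (k + 1)))

theorem inner_mem_localEdges (q : Face) (k : Fin 4) : s(q, q + dir k) ∈ localEdges q :=
  Or.inl ⟨k, rfl⟩

theorem middle_mem_localEdges (q : Face) (k : Fin 4) :
    s(q + dir k, q + dir (k + 1)) ∈ localEdges q :=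
  Or.inr ⟨k, rfl⟩

theorem finite_localEdges (q : Face) : (localEdges q).Finite :=
  (Set.finite_range _).union (Set.finite_range _)

theorem eq_or_eq_of_mem_localEdges {q p : Face} {e : Sym2 Face} (he : e ∈ localEdges q)
    (hp : p ∈ e) : p = q ∨ ∃ k, p = q + dir k := by
  rcases he with ⟨k, rfl⟩ | ⟨k, rfl⟩ <;> rcases Sym2.mem_iff.1 hp with rfl | rfl
  exacts [Or.inl rfl, Or.inr ⟨k, rfl⟩, Or.inr ⟨k, rfl⟩, Or.inr ⟨k + 1, rfl⟩]

theorem outer_notMem_localEdges {q p : Face} (k : Fin 4) :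
    s(q + dir k + dir (k + 1), p) ∉ localEdges q := by
  intro h
  rcases eq_or_eq_of_mem_localEdges h (Sym2.mem_mk_left _ _) with h | ⟨l, h⟩
  · rw [add_assoc, add_eq_left] at h
    revert h; clear * -; revert k; decide
  · rw [add_assoc, add_right_inj] at h
    revert h; clear * -; revert k l; decide

/-- The offsets of the four faces of a square. -/
def squareOffsets (k : Fin 4) : Finset Face := {0, dir k, dir (k + 1), dir k + dir (k + 1)}

/-- Consequently squares that avoid `q` contain no local edge, and their conditions are unaffected
by a change at `q`. -/
theorem sub_mem_squareOffsets_of_mem_localEdges {q r : Face} {k : Fin 4} {u v : Face}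
    (hu : u ∈ squareOffsets k) (hv : v ∈ squareOffsets k) (h : s(r + u, r + v) ∈ localEdges q) :
    q - r ∈ squareOffsets k := by
  have key : ∀ k j : Fin 4, ∀ u ∈ squareOffsets k, ∀ v ∈ squareOffsets k,
      v - u = dir (j + 1) - dir j → u - dir j ∈ squareOffsets k := by decide
  rcases h with ⟨j, hj⟩ | ⟨j, hj⟩ <;> rcases Sym2.eq_iff.1 hj with ⟨h1, h2⟩ | ⟨h1, h2⟩
  · rwa [h1, add_sub_cancel_left]
  · rwa [h1, add_sub_cancel_left]
  · have := key k j u hu v hv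
      (by rw [← add_sub_add_left_eq_sub v u r, ← h1, ← h2, add_sub_add_left_eq_sub])
    rwa [show u - dir j = q - r by rw [eq_sub_iff_add_eq.2 h1]; abel] at this
  · have := key k j v hv u hu
      (by rw [← add_sub_add_left_eq_sub u v r, ← h1, ← h2, add_sub_add_left_eq_sub])
    rwa [show v - dir j = q - r by rw [eq_sub_iff_add_eq.2 h1]; abel] at this

theorem mem_iff_of_diff_eq {α : Type*} {M M' L : Set α} (h : M \ L = M' \ L) {e : α}
    (he : e ∉ L) : e ∈ M ↔ e ∈ M' := by
  have : e ∈ M \ L ↔ e ∈ M' \ L := by rw [h]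
  simpa [he] using this

theorem squareCond_iff_of_diff_eq {g g' : Face → ℤ} {q : Face} (hgg : ∀ p, p ≠ q → g p = g' p)
    {M M' : Set (Sym2 Face)} (hM : M \ localEdges q = M' \ localEdges q) {r : Face} {k : Fin 4}
    (hr : q - r ∉ squareOffsets k) :
    SquareCond g M r (r + dir k) (r + dir (k + 1)) (r + dir k + dir (k + 1)) ↔
      SquareCond g' M' r (r + dir k) (r + dir (k + 1)) (r + dir k + dir (k + 1)) := by
  have h0 : (0 : Face) ∈ squareOffsets k := by simp [squareOffsets]
  have h1 : dir k ∈ squareOffsets k := by simp [squareOffsets]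
  have h2 : dir (k + 1) ∈ squareOffsets k := by simp [squareOffsets]
  have h3 : dir k + dir (k + 1) ∈ squareOffsets k := by simp [squareOffsets]
  have hv : ∀ u ∈ squareOffsets k, g (r + u) = g' (r + u) := by
    intro u hu
    refine hgg _ fun h => hr ?_
    rwa [← h, add_sub_cancel_left]
  have he : ∀ u ∈ squareOffsets k, ∀ v ∈ squareOffsets k,
      (s(r + u, r + v) ∈ M ↔ s(r + u, r + v) ∈ M') := fun u hu v hv =>
    mem_iff_of_diff_eq hM fun h => hr (sub_mem_squareOffsets_of_mem_localEdges hu hv h)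
  have e0 := add_zero r
  rw [add_assoc]
  apply squareCond_congr
  · simpa only [e0] using hv 0 h0
  · exact hv _ h1
  · exact hv _ h2
  · exact hv _ h3
  · simpa only [e0] using he 0 h0 _ h1
  · simpa only [e0] using he 0 h0 _ h2
  · simpa only [e0] using he 0 h0 _ h3
  · exact he _ h1 _ h2
  · exact he _ h1 _ h3
  · exact he _ h2 _ h3

/-- A square that contains `q` can be rotated so that `q` is its first corner. -/
theorem forall_squareCond_iff {g : Face → ℤ} {M : Set (Sym2 Face)} (q : Face) :
    (∀ r k, SquareCond g M r (r + dir k) (r + dir (k + 1)) (r + dir k + dir (k + 1))) ↔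
      (∀ k, SquareCond g M q (q + dir k) (q + dir (k + 1)) (q + dir k + dir (k + 1))) ∧
      ∀ r k, q - r ∉ squareOffsets k →
        SquareCond g M r (r + dir k) (r + dir (k + 1)) (r + dir k + dir (k + 1)) := by
  refine ⟨fun H => ⟨H q, fun r k _ => H r k⟩, fun ⟨H1, H2⟩ r k => ?_⟩
  by_cases hr : q - r ∈ squareOffsets k
  · have e2 : k + 1 + 1 = k + 2 := by rw [add_assoc]; rfl
    have e3 : k + 2 + 1 = k + 3 := by rw [add_assoc]; rfl
    have e4 : k + 3 + 1 = k := by rw [add_assoc]; exact add_zero k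
    have d2 := dir_add_two k
    have d3 := dir_add_three k
    simp only [squareOffsets, Finset.mem_insert, Finset.mem_singleton] at hr
    rcases hr with hr | hr | hr | hr <;> rw [sub_eq_iff_eq_add'] at hr <;> subst hr
    · simpa using H1 k
    · have := (H1 (k + 1)).rotate.rotate.rotate
      rw [e2, d2] at this
      convert this using 1 <;> abel
    · have := (H1 (k + 3)).rotate
      rw [e4, d3] at this
      convert this using 1 <;> abel
    · have := (H1 (k + 2)).reverse
      rw [e3, d2, d3] at this
      convert this using 1 <;> abel
  · exact H2 r k hr

/-- The value at `q` only decides about diagonal edges across from `q`, and these join two lattice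
neighbours of `q`. -/
theorem mem_graphEdges_iff_of_notMem_localEdges {g g' : Face → ℤ} {q : Face}
    (hgg : ∀ p, p ≠ q → g p = g' p) {e : Sym2 Face} (he : e ∉ localEdges q) :
    e ∈ graphEdges g ↔ e ∈ graphEdges g' := by
  induction e with | _ a b
  rw [mem_graphEdges, mem_graphEdges, borders_iff, borders_iff]
  refine or_congr_right (exists_congr fun k => and_congr_right ?_)
  rintro rfl
  have d2 := dir_add_two k
  have d3 := dir_add_three k
  have e2 : k + 1 + 1 = k + 2 := by rw [add_assoc]; rfl
  have e4 : k + 3 + 1 = k := by rw [add_assoc]; exact add_zero k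
  rw [hgg (a + dir k), hgg (a + dir (k + 1))]
  · rintro rfl
    refine he (Or.inr ⟨k + 3, ?_⟩)
    simp only [e4, d3]
    congr 1 <;> simp [add_right_comm]
  · rintro rfl
    refine he (Or.inr ⟨k + 1, ?_⟩)
    simp only [e2, d2]
    rw [Sym2.eq_swap]
    congr 1; simp

section Local

variable {P : ℤ × ℤ × ℤ} {g g₀ : Face → ℤ} {q : Face} {M M₀ : Set (Sym2 Face)}

/-- All conditions away from `q` are inherited from `M₀`. Since `g₀` may differ from `g` at `q`,
matchings before and after raising can be compared with the same outer part. -/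
theorem coneMatching_iff_of_diff_eq (hgg : ∀ p, p ≠ q → g p = g₀ p) (hM₀ : ConeMatching P g₀ M₀)
    (hM : M \ localEdges q = M₀ \ localEdges q) :
    ConeMatching P g M ↔
      (∀ k, s(q + dir k, q + dir (k + 1)) ∈ M → g q ≠ g (q + dir k + dir (k + 1))) ∧
      ∀ k, SquareCond g M q (q + dir k) (q + dir (k + 1)) (q + dir k + dir (k + 1)) := by
  rw [ConeMatching, isMatchingOf_iff, forall_squareCond_iff q]
  constructor
  · rintro ⟨⟨h1, h2, h3⟩, h4⟩
    exact ⟨fun k hk => mem_graphEdges_antidiagonal.1 (h1 hk), h2⟩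
  · rintro ⟨h1, h2⟩
    obtain ⟨hM1, hM2⟩ := hM₀
    rw [isMatchingOf_iff] at hM1
    refine ⟨⟨fun e he => ?_, h2, fun r k hr => ?_⟩, ?_⟩
    · by_cases hl : e ∈ localEdges q
      · rcases hl with ⟨k, rfl⟩ | ⟨k, rfl⟩
        · exact graphEdges_lattice g q k
        · exact mem_graphEdges_antidiagonal.2 (h1 k he)
      · rw [mem_graphEdges_iff_of_notMem_localEdges hgg hl]
        exact hM1.1 ((mem_iff_of_diff_eq hM hl).1 he)
    · exact (squareCond_iff_of_diff_eq hgg hM hr).2 (hM1.2 r k)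
    · refine (hM2.union (finite_localEdges q)).subset fun e he => ?_
      by_cases hl : e ∈ localEdges q
      · exact Or.inr hl
      · left
        have := mem_iff_of_diff_eq hM hl
        simpa only [Set.mem_symmDiff, this] using he

/-- `1` if the outer part of the corner `k` of the face `q` is matched outwards, `0` otherwise. -/
noncomputable def outward (M : Set (Sym2 Face)) (q : Face) (k : Fin 4) : ℤ :=
  ind M (q + dir k + dir (k + 1)) (q + dir k) + ind M (q + dir k + dir (k + 1)) (q + dir (k + 1))

/-- `1` if the inner vertex at the corner `k` of the face `q` has to be matched by an edge of that
face, `0` otherwise. -/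
noncomputable def demand (g : Face → ℤ) (M : Set (Sym2 Face)) (q : Face) (k : Fin 4) : ℤ :=
  if g q = g (q + dir k + dir (k + 1)) then 1 - outward M q k else outward M q k

theorem outward_congr (hM : M \ localEdges q = M₀ \ localEdges q) (k : Fin 4) :
    outward M q k = outward M₀ q k := by
  rw [outward, outward, ind_congr (mem_iff_of_diff_eq hM (outer_notMem_localEdges k)),
    ind_congr (mem_iff_of_diff_eq hM (outer_notMem_localEdges k))]

theorem demand_congr (hM : M \ localEdges q = M₀ \ localEdges q) (k : Fin 4) :
    demand g M q k = demand g M₀ q k := by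
  rw [demand, demand, outward_congr hM]

/-- At a cross the single vertex sees the two edges of `q` and the two outer edges. At a wrench the
outer vertex determines the middle edge from `outward`, and the inner vertex then fixes the number
of edges of `q`. -/
theorem coneMatching_iff_demand (hflat : ∀ k, g (q + dir k) = g (q + dir (k + 1)))
    (hgg : ∀ p, p ≠ q → g p = g₀ p) (hM₀ : ConeMatching P g₀ M₀)
    (hM : M \ localEdges q = M₀ \ localEdges q) :
    ConeMatching P g M ↔ ∀ k,
      ind M q (q + dir k) + ind M q (q + dir (k + 1)) = demand g M q k ∧
      ind M (q + dir k) (q + dir (k + 1)) =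
        if g q = g (q + dir k + dir (k + 1)) then 0 else 1 - outward M q k := by
  rw [coneMatching_iff_of_diff_eq hgg hM₀ hM, ← forall_and]
  refine forall_congr' fun k => ?_
  have hk := hflat k
  rw [SquareCond, demand, outward]
  by_cases h : g q = g (q + dir k + dir (k + 1))
  · simp only [h, hk, ne_eq, not_true_eq_false, imp_false, false_implies, and_true, true_implies,
      if_true, ind_eq_zero]
    rw [and_comm]
    refine and_congr_left fun _ => ?_
    constructor <;> intro h <;> linarith
  · simp only [h, hk, ne_eq, not_true_eq_false, not_false_eq_true, false_implies, and_true,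
      true_implies, if_false, implies_true, true_and]
    constructor <;> rintro ⟨h1, h2⟩ <;> constructor <;> linarith

theorem outward_eq_zero_or_one (hflat : ∀ k, g (q + dir k) = g (q + dir (k + 1)))
    (hM : ConeMatching P g M) (k : Fin 4) : outward M q k = 0 ∨ outward M q k = 1 := by
  have h := (coneMatching_iff_demand hflat (fun _ _ => rfl) hM rfl).1 hM k
  have h1 := ind_nonneg M q (q + dir k)
  have h2 := ind_nonneg M q (q + dir (k + 1))
  have h3 : 0 ≤ outward M q k := add_nonneg (ind_nonneg _ _ _) (ind_nonneg _ _ _)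
  have h4 := ind_nonneg M (q + dir k) (q + dir (k + 1))
  rw [demand] at h
  split_ifs at h <;> omega

/-- The part of the balance of the face `q + dir k` that is due to edges which are not local
edges of `q`. -/
noncomputable def outerBalance (g : Face → ℤ) (M : Set (Sym2 Face)) (q : Face) (k : Fin 4) : ℤ :=
  (1 - 2 * ind M (q + dir k) (q + dir k + dir k)) +
  (1 - 2 * ind M (q + dir k) (q + dir k + dir (k + 1))) +
  (1 - 2 * ind M (q + dir k) (q + dir k + dir (k + 3))) +
  (if g (q + dir k + dir k) ≠ g (q + dir k + dir (k + 1)) then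
    1 - 2 * ind M (q + dir k) (q + dir k + dir k + dir (k + 1)) else 0) +
  (if g (q + dir k + dir (k + 3)) ≠ g (q + dir k + dir k) then
    1 - 2 * ind M (q + dir k) (q + dir k + dir (k + 3) + dir k) else 0)

theorem sum_fin_four_shift (f : Fin 4 → ℤ) (k : Fin 4) :
    ∑ j, f j = f k + f (k + 1) + f (k + 2) + f (k + 3) := by
  rw [Fin.sum_univ_four]
  fin_cases k
  · rfl
  all_goals simp only [Fin.isValue, Fin.mk_one, Fin.reduceFinMk, Fin.reduceAdd]; ring

theorem balance_neighbor (g : Face → ℤ) (M : Set (Sym2 Face)) (q : Face) (k : Fin 4) :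
    balance g M (q + dir k) = outerBalance g M q k + (1 - 2 * ind M q (q + dir k)) +
      (if g q ≠ g (q + dir k + dir (k + 1)) then
        1 - 2 * ind M (q + dir k) (q + dir (k + 1)) else 0) +
      (if g q ≠ g (q + dir (k + 3) + dir (k + 3 + 1)) then
        1 - 2 * ind M (q + dir (k + 3)) (q + dir (k + 3 + 1)) else 0) := by
  have e2 : k + 1 + 1 = k + 2 := by rw [add_assoc]; rfl
  have e3 : k + 2 + 1 = k + 3 := by rw [add_assoc]; rfl
  have e4 : k + 3 + 1 = k := by rw [add_assoc]; exact add_zero k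
  have d2 := dir_add_two k
  have a1 : q + dir k + dir (k + 2) = q := by rw [d2]; abel
  have a2 : q + dir k + dir (k + 1) + dir (k + 2) = q + dir (k + 1) := by rw [d2]; abel
  have a3 : q + dir k + dir (k + 3) = q + dir (k + 3) + dir k := by abel
  rw [balance, sum_fin_four_shift _ k, sum_fin_four_shift _ k, outerBalance]
  simp only [e2, e3, e4, a1, a2, a3, ne_comm (a := g q)]
  rw [ind_comm M q, ind_comm M (q + dir (k + 3))]
  simp only [ne_comm (b := g q)]
  ring

theorem outerBalance_congr (hgg : ∀ p, p ≠ q → g p = g₀ p)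
    (hM : M \ localEdges q = M₀ \ localEdges q) (k : Fin 4) :
    outerBalance g M q k = outerBalance g₀ M₀ q k := by
  have hv : ∀ v : Face, v ≠ 0 → g (q + v) = g₀ (q + v) := fun v hv =>
    hgg _ fun h => hv (by simpa using h)
  have n1 : dir k + dir k ≠ 0 := by revert k; decide
  have n2 : dir k + dir (k + 1) ≠ 0 := by revert k; decide
  have n3 : dir k + dir (k + 3) ≠ 0 := by revert k; decide
  have hi : ∀ v : Face, v ≠ 0 → (∀ l, v ≠ dir l) →
      ind M (q + dir k) (q + v) = ind M₀ (q + dir k) (q + v) := by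
    intro v h0 h1
    refine ind_congr (mem_iff_of_diff_eq hM fun h => ?_)
    rcases eq_or_eq_of_mem_localEdges h (Sym2.mem_mk_right _ _) with h | ⟨l, h⟩
    · exact h0 (by simpa using h)
    · exact h1 l (by simpa using h)
  have i1 : ∀ l, dir k + dir k ≠ dir l := by clear * -; revert k; decide
  have i2 : ∀ l, dir k + dir (k + 1) ≠ dir l := by clear * -; revert k; decide
  have i3 : ∀ l, dir k + dir (k + 3) ≠ dir l := by clear * -; revert k; decide
  have i4 : ∀ l, dir k + (dir k + dir (k + 1)) ≠ dir l := by clear * -; revert k; decide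
  have i5 : ∀ l, dir k + (dir (k + 3) + dir k) ≠ dir l := by clear * -; revert k; decide
  have n4 : dir k + (dir k + dir (k + 1)) ≠ 0 := by clear * -; revert k; decide
  have n5 : dir k + (dir (k + 3) + dir k) ≠ 0 := by clear * -; revert k; decide
  simp only [outerBalance, add_assoc, hv _ n1, hv _ n2, hv _ n3, hi _ n1 i1, hi _ n2 i2,
    hi _ n3 i3, hi _ n4 i4, hi _ n5 i5]

/-- The exponent of the face `q + dir k`, without the contribution of its edge to `q`. -/
noncomputable def outerExponent (g : Face → ℤ) (M : Set (Sym2 Face)) (q : Face) (k : Fin 4) : ℤ :=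
  (outerBalance g M q k + 2 +
    (if g q ≠ g (q + dir k + dir (k + 1)) then 2 * outward M q k - 1 else 0) +
    (if g q ≠ g (q + dir (k + 3) + dir (k + 3 + 1)) then
      2 * outward M q (k + 3) - 1 else 0)) / 2 - 1

theorem outerExponent_congr (hM : M \ localEdges q = M₀ \ localEdges q) (k : Fin 4) :
    outerExponent g M q k = outerExponent g M₀ q k := by
  simp only [outerExponent, outerBalance_congr (fun _ _ => rfl) hM, outward_congr hM]

/-- The middle edges at the two adjacent corners are expressed through `outward`. Using the edge to
`q` lowers the balance by 2, hence the exponent by exactly 1 in spite of the rounding. -/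
theorem faceExponent_neighbor (hflat : ∀ k, g (q + dir k) = g (q + dir (k + 1)))
    (hM : ConeMatching P g M) (k : Fin 4) :
    faceExponent g M (q + dir k) = outerExponent g M q k - ind M q (q + dir k) := by
  have h1 := ((coneMatching_iff_demand hflat (fun _ _ => rfl) hM rfl).1 hM k).2
  have h2 := ((coneMatching_iff_demand hflat (fun _ _ => rfl) hM rfl).1 hM (k + 3)).2
  rw [faceExponent_eq, balance_neighbor, outerExponent, h1, h2]
  split_ifs <;> omega

/-- No middle edge borders `q`, so the face is a quadrilateral. -/
theorem faceExponent_center (hflat : ∀ k, g (q + dir k) = g (q + dir (k + 1))) :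
    faceExponent g M q = 1 - ∑ k, ind M q (q + dir k) := by
  have : ∀ k, g (q + dir k) = g (q + dir 0) := by
    have h0 := hflat 0
    have h1 := hflat 1
    have h2 := hflat 2
    simp only [Fin.isValue, zero_add, Fin.reduceAdd] at h0 h1 h2
    intro k
    fin_cases k
    exacts [rfl, h0.symm, h1.symm.trans h0.symm, h2.symm.trans (h1.symm.trans h0.symm)]
  rw [faceExponent_eq, balance]
  simp only [this, ne_eq, not_true_eq_false, if_false, Finset.sum_const_zero, add_zero,
    Finset.sum_sub_distrib, ← Finset.mul_sum]
  simp
  omega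

end Local

/-! ### The algebraic identity behind urban renewal. -/

/-- The function on `Fin 4` with values in `{0, 1}` that is given by four Booleans. -/
def bits (X : Bool × Bool × Bool × Bool) : Fin 4 → ℤ :=
  ![X.1.toInt, X.2.1.toInt, X.2.2.1.toInt, X.2.2.2.toInt]

theorem bits_injective : Function.Injective bits := by
  intro X Y; revert X Y; decide

theorem bits_nonneg (X : Bool × Bool × Bool × Bool) (k : Fin 4) : bits X k = 0 ∨ bits X k = 1 := by
  revert X k; decide

theorem exists_bits_eq {x : Fin 4 → ℤ} (hx : ∀ k, x k = 0 ∨ x k = 1) : ∃ X, bits X = x := by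
  refine ⟨(x 0 = 1, x 1 = 1, x 2 = 1, x 3 = 1), ?_⟩
  funext k
  have := hx k
  fin_cases k <;> rcases this with h | h <;> simp_all [bits]

/-- If `T` is constantly `0`, the left side has one term and the right side two, coming from the two
pairs of opposite edges; if `T` is constantly `1`, the roles are exchanged. These two cases are
`hrec`. If `T` is `1` at two adjacent corners only, each side has one term, with opposite edges
used. For every other `T` both sums are empty. -/
theorem sum_bits_renewal_aux {K : Type*} [Field K] (ω y : Fin 4 → K) (a a' : K) (hy : ∀ k, y k ≠ 0)
    (ha : a ≠ 0) (ha' : a' ≠ 0)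
    (hrec : a' * a = ω 0 * ω 2 * (y 1 * y 3) + ω 1 * ω 3 * (y 0 * y 2)) (T : Fin 4 → ℤ)
    (hT : ∀ k, T k = 0 ∨ T k = 1) :
    (∑ X, if ∀ k, bits X k + bits X (k + 1) = T k then
      (∏ k, ω k ^ bits X k) * a ^ (1 - ∑ k, bits X k) * ∏ k, y k ^ (-bits X k) else 0) =
    ∑ X, if ∀ k, bits X k + bits X (k + 1) = 1 - T k then
      (∏ k, ω (k + 2) ^ bits X k) * a' ^ (1 - ∑ k, bits X k) *
        ∏ k, y k ^ (1 - T k - T (k + 3) - bits X k) else 0 := by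
  obtain ⟨Y, rfl⟩ := exists_bits_eq hT
  have y0 := hy 0
  have y1 := hy 1
  have y2 := hy 2
  have y3 := hy 3
  obtain ⟨b0, b1, b2, b3⟩ := Y
  simp only [Fin.forall_fin_succ, Fintype.sum_prod_type, Fintype.sum_bool, Fin.sum_univ_four,
    Fin.prod_univ_four]
  cases b0 <;> cases b1 <;> cases b2 <;> cases b3 <;> simp [bits]
  · field_simp
    linear_combination hrec
  · field_simp
    linear_combination -hrec

theorem sum_bits_renewal {K : Type*} [Field K] (ω y : Fin 4 → K) (a a' : K) (hy : ∀ k, y k ≠ 0)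
    (ha : a ≠ 0) (ha' : a' ≠ 0)
    (hrec : a' * a = ω 0 * ω 2 * (y 1 * y 3) + ω 1 * ω 3 * (y 0 * y 2)) (T T' κ κ' : Fin 4 → ℤ)
    (hT : ∀ k, T k = 0 ∨ T k = 1) (hT' : ∀ k, T' k = 1 - T k)
    (hκ : ∀ k, κ' k = κ k + 1 - T k - T (k + 3)) :
    (∑ X, if ∀ k, bits X k + bits X (k + 1) = T k then
      (∏ k, ω k ^ bits X k) * a ^ (1 - ∑ k, bits X k) * ∏ k, y k ^ (κ k - bits X k) else 0) =
    ∑ X, if ∀ k, bits X k + bits X (k + 1) = T' k then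
      (∏ k, ω (k + 2) ^ bits X k) * a' ^ (1 - ∑ k, bits X k) *
        ∏ k, y k ^ (κ' k - bits X k) else 0 := by
  have h1 : ∀ X, ∏ k, y k ^ (κ k - bits X k) = (∏ k, y k ^ κ k) * ∏ k, y k ^ (-bits X k) := by
    intro X
    rw [← Finset.prod_mul_distrib]
    refine Finset.prod_congr rfl fun k _ => ?_
    rw [← zpow_add₀ (hy k), sub_eq_add_neg]
  have h2 : ∀ X, ∏ k, y k ^ (κ' k - bits X k) =
      (∏ k, y k ^ κ k) * ∏ k, y k ^ (1 - T k - T (k + 3) - bits X k) := by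
    intro X
    rw [← Finset.prod_mul_distrib]
    refine Finset.prod_congr rfl fun k _ => ?_
    rw [← zpow_add₀ (hy k), hκ]
    congr 1
    ring
  have h3 := congrArg ((∏ k, y k ^ κ k) * ·)
    (sum_bits_renewal_aux ω y a a' hy ha ha' hrec T hT)
  simp only [Finset.mul_sum, mul_ite, mul_zero] at h3
  convert h3 using 1 <;> refine Finset.sum_congr rfl fun X _ => ?_
  · rw [h1]
    split_ifs <;> ring
  · rw [h2]
    simp only [hT']
    split_ifs <;> ring

/-! ### Matchings with a prescribed part outside the local edges, and their monomials. -/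

theorem inner_injective (q : Face) : Function.Injective fun k => s(q, q + dir k) := by
  intro k l h
  simpa [dir_injective.eq_iff, dir_ne_zero] using h

theorem middle_injective (q : Face) : Function.Injective fun k => s(q + dir k, q + dir (k + 1)) := by
  intro k l h
  have h := Sym2.eq_iff.1 h
  simp only [add_right_inj] at h
  revert h; clear * -; revert k l; decide

theorem inner_ne_middle (q : Face) (k l : Fin 4) :
    s(q, q + dir k) ≠ s(q + dir l, q + dir (l + 1)) := by
  intro h
  rcases Sym2.eq_iff.1 h with ⟨h, -⟩ | ⟨h, -⟩
  · exact dir_ne_zero l (by simpa using h.symm)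
  · exact dir_ne_zero (l + 1) (by simpa using h.symm)

section Local

variable {P : ℤ × ℤ × ℤ} {g g₀ : Face → ℤ} {q : Face} {M M₀ : Set (Sym2 Face)}

theorem exists_coneMatching_of_bits (hflat : ∀ k, g (q + dir k) = g (q + dir (k + 1)))
    (hgg : ∀ p, p ≠ q → g p = g₀ p) (hM₀ : ConeMatching P g₀ M₀)
    (hout : ∀ k, outward M₀ q k = 0 ∨ outward M₀ q k = 1) {x : Fin 4 → ℤ}
    (hx : ∀ k, x k = 0 ∨ x k = 1) (hxd : ∀ k, x k + x (k + 1) = demand g M₀ q k) :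
    ∃ M, ConeMatching P g M ∧ M \ localEdges q = M₀ \ localEdges q ∧
      ∀ k, ind M q (q + dir k) = x k := by
  -- The middle edges are forced: one is used exactly at a wrench whose outer vertex is not matched
  -- outwards.
  set M : Set (Sym2 Face) := (M₀ \ localEdges q) ∪ {e | ∃ k, e = s(q, q + dir k) ∧ x k = 1} ∪
    {e | ∃ k, e = s(q + dir k, q + dir (k + 1)) ∧
      g q ≠ g (q + dir k + dir (k + 1)) ∧ outward M₀ q k = 0} with hM
  have h1 : M \ localEdges q = M₀ \ localEdges q := by
    ext e
    constructor
    · rintro ⟨(h | ⟨k, rfl, -⟩) | ⟨k, rfl, -⟩, hl⟩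
      exacts [h, absurd (inner_mem_localEdges q k) hl, absurd (middle_mem_localEdges q k) hl]
    · exact fun h => ⟨Or.inl (Or.inl h), h.2⟩
  have h2 : ∀ k, s(q, q + dir k) ∈ M ↔ x k = 1 := by
    intro k
    constructor
    · rintro ((h | ⟨l, h, hl⟩) | ⟨l, h, -⟩)
      · exact absurd (inner_mem_localEdges q k) h.2
      · rwa [inner_injective q h]
      · exact absurd h (inner_ne_middle q k l)
    · exact fun h => Or.inl (Or.inr ⟨k, rfl, h⟩)
  have h3 : ∀ k, s(q + dir k, q + dir (k + 1)) ∈ M ↔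
      g q ≠ g (q + dir k + dir (k + 1)) ∧ outward M₀ q k = 0 := by
    intro k
    constructor
    · rintro ((h | ⟨l, h, -⟩) | ⟨l, h, hl⟩)
      · exact absurd (middle_mem_localEdges q k) h.2
      · exact absurd h.symm (inner_ne_middle q l k)
      · rwa [middle_injective q h]
    · exact fun h => Or.inr ⟨k, rfl, h⟩
  have h4 : ∀ k, ind M q (q + dir k) = x k := by
    intro k
    rcases hx k with h | h
    · rw [h, ind_eq_zero, h2, h]; norm_num
    · rw [h, ind_eq_one, h2, h]
  refine ⟨M, (coneMatching_iff_demand hflat hgg hM₀ h1).2 fun k => ⟨?_, ?_⟩, h1, h4⟩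
  · rw [h4, h4, hxd, demand_congr h1]
  · rw [outward_congr h1]
    split_ifs with h
    · rw [ind_eq_zero, h3]
      exact fun h' => h'.1 h
    · rcases hout k with h' | h' <;> rw [h']
      · exact ind_eq_one.2 ((h3 k).2 ⟨h, h'⟩)
      · refine ind_eq_zero.2 fun hm => ?_
        have := ((h3 k).1 hm).2
        omega

/-- Within a fibre the middle edges are forced, so a matching is the choice of its edges at `q`, and
`demand` is the only constraint on that choice. -/
theorem sum_fiber (hflat : ∀ k, g (q + dir k) = g (q + dir (k + 1)))
    (hgg : ∀ p, p ≠ q → g p = g₀ p) (hM₀ : ConeMatching P g₀ M₀)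
    (hout : ∀ k, outward M₀ q k = 0 ∨ outward M₀ q k = 1)
    (S : Finset (Set (Sym2 Face)))
    (hS : ∀ M, M ∈ S ↔ ConeMatching P g M ∧ M \ localEdges q = M₀ \ localEdges q)
    {K : Type*} [AddCommMonoid K] (F : (Fin 4 → ℤ) → K) :
    ∑ M ∈ S, F (fun k => ind M q (q + dir k)) =
      ∑ X, if ∀ k, bits X k + bits X (k + 1) = demand g M₀ q k then F (bits X) else 0 := by
  rw [← Finset.sum_filter]
  have hex : ∀ M : Set (Sym2 Face), ∃ X, bits X = fun k => ind M q (q + dir k) := fun M =>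
    exists_bits_eq fun k => by
      have h1 := ind_nonneg M q (q + dir k)
      have h2 := ind_le_one M q (q + dir k)
      omega
  choose X hX using hex
  refine Finset.sum_bij (fun M _ => X M) ?_ ?_ ?_ ?_
  · intro M hM
    rw [hS] at hM
    rw [Finset.mem_filter]
    refine ⟨Finset.mem_univ _, fun k => ?_⟩
    rw [hX, ← demand_congr hM.2]
    exact ((coneMatching_iff_demand hflat hgg hM₀ hM.2).1 hM.1 k).1
  · intro M hM M' hM' h
    rw [hS] at hM hM'
    have h0 : M \ localEdges q = M' \ localEdges q := hM.2.trans hM'.2.symm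
    have h1 := (coneMatching_iff_demand hflat hgg hM₀ hM.2).1 hM.1
    have h2 := (coneMatching_iff_demand hflat hgg hM₀ hM'.2).1 hM'.1
    have h3 := (hX M).symm.trans ((congrArg bits h).trans (hX M'))
    ext e
    by_cases hl : e ∈ localEdges q
    · rcases hl with ⟨k, rfl⟩ | ⟨k, rfl⟩
      · simp only
        rw [← ind_eq_one, ← ind_eq_one, congrFun h3 k]
      · simp only
        rw [← ind_eq_one, ← ind_eq_one, (h1 k).2, (h2 k).2, outward_congr h0]
    · exact mem_iff_of_diff_eq h0 hl
  · intro Y hY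
    rw [Finset.mem_filter] at hY
    obtain ⟨M, hM1, hM2, hM3⟩ := exists_coneMatching_of_bits hflat hgg hM₀ hout
      (bits_nonneg Y) hY.2
    refine ⟨M, (hS M).2 ⟨hM1, hM2⟩, bits_injective ?_⟩
    rw [hX]
    exact funext hM3
  · intro M _
    rw [hX]

theorem edgeWeight_congr (hgg : ∀ p, p ≠ q → g p = g₀ p) {e : Sym2 Face}
    (he : e ∉ localEdges q) : edgeWeight g e = edgeWeight g₀ e := by
  induction e with | _ a b
  by_cases hab : LatticeAdjacent a b
  · have ha : a ≠ q := by
      rintro rfl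
      obtain ⟨k, rfl⟩ := latticeAdjacent_iff.1 hab
      exact he (inner_mem_localEdges a k)
    have hb : b ≠ q := by
      rintro rfl
      obtain ⟨k, rfl⟩ := latticeAdjacent_iff.1 (latticeAdjacent_comm.1 hab)
      exact he (Sym2.eq_swap ▸ inner_mem_localEdges b k)
    simp only [edgeWeight, Sym2.lift_mk, orientedWeight, hgg a ha, hgg b hb]
  · rw [edgeWeight_eq_one hab, edgeWeight_eq_one hab]

theorem faceExponent_congr (hgg : ∀ p, p ≠ q → g p = g₀ p)
    (hM : M \ localEdges q = M₀ \ localEdges q) {p : Face} (hp : p ≠ q)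
    (hpk : ∀ k, p ≠ q + dir k) : faceExponent g M p = faceExponent g₀ M₀ p := by
  have hl : ∀ e, p ∈ e → e ∉ localEdges q := by
    intro e hpe he
    rcases eq_or_eq_of_mem_localEdges he hpe with h | ⟨k, h⟩
    exacts [hp h, hpk k h]
  have h1 : faceEdges g p \ M = faceEdges g₀ p \ M₀ := by
    ext e
    simp only [faceEdges, Set.mem_sdiff, Set.mem_ofPred_eq]
    by_cases hpe : p ∈ e
    · rw [mem_graphEdges_iff_of_notMem_localEdges hgg (hl e hpe),
        mem_iff_of_diff_eq hM (hl e hpe)]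
    · simp [hpe]
  have h2 : faceEdges g p ∩ M = faceEdges g₀ p ∩ M₀ := by
    ext e
    simp only [faceEdges, Set.mem_inter_iff, Set.mem_ofPred_eq]
    by_cases hpe : p ∈ e
    · rw [mem_graphEdges_iff_of_notMem_localEdges hgg (hl e hpe),
        mem_iff_of_diff_eq hM (hl e hpe)]
    · simp [hpe]
  rw [faceExponent, faceExponent, h1, h2]

/-- The face `q` and its four lattice neighbours. -/
def plus (q : Face) : Finset Face := insert q (Finset.univ.image fun k => q + dir k)

/-- The part of the monomial of `M` that does not depend on the local edges of `q`. -/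
noncomputable def outerMonomial (y : ℤ → Face → OctField) (g : Face → ℤ) (M : Set (Sym2 Face))
    (q : Face) : OctField :=
  (∏ᶠ e ∈ M \ localEdges q, edgeWeight g e) *
    ∏ᶠ p ∈ (Set.univ \ (plus q : Set Face)), y (g p) p ^ faceExponent g M p

theorem outerMonomial_congr (y : ℤ → Face → OctField) (hgg : ∀ p, p ≠ q → g p = g₀ p)
    (hM : M \ localEdges q = M₀ \ localEdges q) :
    outerMonomial y g M q = outerMonomial y g₀ M₀ q := by
  rw [outerMonomial, outerMonomial]
  congr 1
  · exact finprod_mem_congr hM fun e he => edgeWeight_congr hgg he.2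
  · refine finprod_mem_congr rfl fun p hp => ?_
    have hp' := hp.2
    simp only [plus, Finset.coe_insert, Finset.coe_image, Finset.coe_univ, Set.image_univ,
      Set.mem_insert_iff, Set.mem_range, not_or, not_exists] at hp'
    rw [faceExponent_congr hgg hM hp'.1 fun k h => hp'.2 k h.symm, hgg p hp'.1]

open Classical in
theorem heightMonomial_eq (y : ℤ → Face → OctField)
    (hflat : ∀ k, g (q + dir k) = g (q + dir (k + 1))) (hM : ConeMatching P g M)
    (hfin : {p | faceExponent g M p ≠ 0}.Finite) :
    heightMonomial y g M = outerMonomial y g M q *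
      ((∏ k, edgeWeight g s(q, q + dir k) ^ ind M q (q + dir k)) *
        y (g q) q ^ (1 - ∑ k, ind M q (q + dir k)) *
        ∏ k, y (g (q + dir k)) (q + dir k) ^ (outerExponent g M q k - ind M q (q + dir k))) := by
  have h1 : ∏ᶠ e ∈ M ∩ localEdges q, edgeWeight g e =
      ∏ k, edgeWeight g s(q, q + dir k) ^ ind M q (q + dir k) := by
    have h2 : ∏ k, edgeWeight g s(q, q + dir k) ^ ind M q (q + dir k) =
        ∏ e ∈ Finset.univ.image (fun k => s(q, q + dir k)), ∏ᶠ _ : e ∈ M ∩ localEdges q,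
          edgeWeight g e := by
      rw [Finset.prod_image fun k _ l _ h => inner_injective q h]
      refine Finset.prod_congr rfl fun k _ => ?_
      by_cases hk : s(q, q + dir k) ∈ M
      · rw [ind_eq_one.2 hk, zpow_one]
        simp [hk, inner_mem_localEdges q k]
      · rw [ind_eq_zero.2 hk, zpow_zero]
        simp [hk]
    rw [h2]
    refine finprod_eq_prod_of_mulSupport_subset _ fun e he => ?_
    rw [Function.mem_mulSupport] at he
    by_cases hm : e ∈ M ∩ localEdges q
    · rcases hm.2 with ⟨k, rfl⟩ | ⟨k, rfl⟩
      · exact Finset.mem_coe.2 (Finset.mem_image_of_mem _ (Finset.mem_univ k))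
      · exfalso
        refine he ?_
        have : edgeWeight g s(q + dir k, q + dir (k + 1)) = 1 := by
          rw [antidiagonal_eq q k]
          exact edgeWeight_eq_one (not_latticeAdjacent_diagonal _ _)
        simp [this]
    · exact absurd (by simp [hm]) he
  have h2 : ∏ᶠ p ∈ Set.univ ∩ (plus q : Set Face), y (g p) p ^ faceExponent g M p =
      y (g q) q ^ (1 - ∑ k, ind M q (q + dir k)) *
        ∏ k, y (g (q + dir k)) (q + dir k) ^ (outerExponent g M q k - ind M q (q + dir k)) := by
    rw [Set.univ_inter, finprod_mem_coe_finset, plus, Finset.prod_insert, Finset.prod_image,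
      faceExponent_center hflat]
    · simp only [faceExponent_neighbor hflat hM]
    · intro k _ l _ h
      exact dir_injective (add_left_cancel h)
    · simp [dir_ne_zero]
  -- A `finprod` with infinite support is `1` by convention, so splitting off factors requires both
  -- supports to be finite.
  have hw : (M ∩ Function.mulSupport (edgeWeight g)).Finite := hM.finite_edgeWeight_ne_one g
  have hy : (Set.univ ∩ Function.mulSupport fun p => y (g p) p ^ faceExponent g M p).Finite := by
    refine hfin.subset ?_
    rintro p ⟨-, hp⟩ h0
    exact hp (by simp only [h0, zpow_zero])
  rw [heightMonomial, outerMonomial, ← finprod_mem_inter_mul_sdiff' (localEdges q) hw, h1,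
    ← finprod_mem_univ (fun p => y (g p) p ^ faceExponent g M p),
    ← finprod_mem_inter_mul_sdiff' (plus q : Set Face) hy, h2]
  ring

end Local

/-! ### Urban renewal. -/

/-- For instance, with `n = g q`, the right edge of `q` carries `a(i + 1 + n, j)` before raising;
the left edge carries it afterwards, as it then ascends from height `n + 1` at `(i - 1, j)`. -/
theorem edgeWeight_eq_edgeWeight_opposite {g g' : Face → ℤ} {q : Face}
    (hloc : ∀ k, g (q + dir k) = g q + 1) (hloc' : ∀ k, g' (q + dir k) = g q + 1)
    (hq : g' q = g q + 2) (k : Fin 4) :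
    edgeWeight g' s(q, q + dir k) = edgeWeight g s(q, q + dir (k + 2)) := by
  obtain ⟨i, j⟩ := q
  have h0 := hloc 0
  have h1 := hloc 1
  have h2 := hloc 2
  have h3 := hloc 3
  have h0' := hloc' 0
  have h1' := hloc' 1
  have h2' := hloc' 2
  have h3' := hloc' 3
  simp [dir, ← sub_eq_add_neg] at h0 h1 h2 h3 h0' h1' h2' h3'
  fin_cases k <;>
    simp [edgeWeight, orientedWeight, dir, ← sub_eq_add_neg, *] <;>
    (try rw [if_neg (by omega), if_neg (by omega)]) <;> ring_nf

/-- The indices are written for the height `g (i, j) + 2`, where the recurrence is applied. -/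
theorem edgeWeight_inner {g : Face → ℤ} {i j : ℤ} (hloc : ∀ k, g ((i, j) + dir k) = g (i, j) + 1) :
    edgeWeight g s((i, j), (i, j) + dir 0) = edgeVar .a (i + (g (i, j) + 2) - 1) j ∧
    edgeWeight g s((i, j), (i, j) + dir 1) = edgeVar .b i (j + (g (i, j) + 2) - 1) ∧
    edgeWeight g s((i, j), (i, j) + dir 2) = edgeVar .c (i - (g (i, j) + 2) + 1) j ∧
    edgeWeight g s((i, j), (i, j) + dir 3) = edgeVar .d i (j - (g (i, j) + 2) + 1) := by
  have h0 := hloc 0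
  have h1 := hloc 1
  have h2 := hloc 2
  have h3 := hloc 3
  simp [dir, ← sub_eq_add_neg] at h0 h1 h2 h3
  refine ⟨?_, ?_, ?_, ?_⟩ <;>
    simp [edgeWeight, orientedWeight, dir, ← sub_eq_add_neg, *] <;>
    rw [if_neg (by omega)] <;> ring_nf

theorem finsum_heightMonomial_renewal {P : ℤ × ℤ × ℤ} {y : ℤ → Face → OctField}
    (hy : ∀ n p, y n p ≠ 0) {g g' : Face → ℤ} {q : Face} (hg : IsPseudoHeightFunction g)
    (hgg : ∀ p, p ≠ q → g' p = g p) (hloc : ∀ k, g (q + dir k) = g q + 1) (hq : g' q = g q + 2)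
    (hfin : {M | ConeMatching P g M}.Finite) (hfin' : {M | ConeMatching P g' M}.Finite)
    (hexp : ∀ M, ConeMatching P g M → {p | faceExponent g M p ≠ 0}.Finite)
    (hexp' : ∀ M, ConeMatching P g' M → {p | faceExponent g' M p ≠ 0}.Finite)
    (hrec : y (g q + 2) q * y (g q) q =
      edgeWeight g s(q, q + dir 0) * edgeWeight g s(q, q + dir 2) *
        (y (g q + 1) (q + dir 1) * y (g q + 1) (q + dir 3)) +
      edgeWeight g s(q, q + dir 1) * edgeWeight g s(q, q + dir 3) *
        (y (g q + 1) (q + dir 0) * y (g q + 1) (q + dir 2))) :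
    ∑ᶠ M ∈ {M | ConeMatching P g M}, heightMonomial y g M =
      ∑ᶠ M ∈ {M | ConeMatching P g' M}, heightMonomial y g' M := by
  classical
  have hne : ∀ k, q + dir k ≠ q := fun k => by simp [dir_ne_zero]
  have hneD : ∀ k, q + dir k + dir (k + 1) ≠ q := fun k => by
    rw [add_assoc, Ne, add_eq_left]
    revert k; decide
  have hloc' : ∀ k, g' (q + dir k) = g q + 1 := fun k => by rw [hgg _ (hne k), hloc]
  have hflat : ∀ k, g (q + dir k) = g (q + dir (k + 1)) := fun k => by rw [hloc, hloc]
  have hflat' : ∀ k, g' (q + dir k) = g' (q + dir (k + 1)) := fun k => by rw [hloc', hloc']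
  have hw := edgeWeight_eq_edgeWeight_opposite hloc hloc' hq
  -- The first alternative is a cross and the second a wrench; with `g'` it is the other way round.
  have hD : ∀ k, g (q + dir k + dir (k + 1)) = g q ∨ g (q + dir k + dir (k + 1)) = g q + 2 := by
    intro k
    have := hg.dir_eq (q + dir k) (k + 1)
    rw [hloc] at this
    omega
  have hD' : ∀ k, g' (q + dir k + dir (k + 1)) = g (q + dir k + dir (k + 1)) := fun k =>
    hgg _ (hneD k)
  -- The reference matching `M₀` may belong to either graph, so no correspondence between nonempty
  -- fibres is presupposed.
  have key : ∀ g₀ M₀, (∀ p, p ≠ q → g p = g₀ p) → (∀ k, g₀ (q + dir k) = g₀ (q + dir (k + 1))) →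
      ConeMatching P g₀ M₀ →
      ∑ M ∈ hfin.toFinset with M \ localEdges q = M₀ \ localEdges q, heightMonomial y g M =
      ∑ M ∈ hfin'.toFinset with M \ localEdges q = M₀ \ localEdges q, heightMonomial y g' M := by
    intro g₀ M₀ hg₀ hflat₀ hM₀
    have hout := outward_eq_zero_or_one hflat₀ hM₀
    have hg₀' : ∀ p, p ≠ q → g' p = g₀ p := fun p hp => (hgg p hp).trans (hg₀ p hp)
    have hS : ∀ M, M ∈ hfin.toFinset.filter (fun M => M \ localEdges q = M₀ \ localEdges q) ↔
        ConeMatching P g M ∧ M \ localEdges q = M₀ \ localEdges q := by simp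
    have hS' : ∀ M, M ∈ hfin'.toFinset.filter (fun M => M \ localEdges q = M₀ \ localEdges q) ↔
        ConeMatching P g' M ∧ M \ localEdges q = M₀ \ localEdges q := by simp
    let F : (Fin 4 → ℤ) → OctField := fun x => (∏ k, edgeWeight g s(q, q + dir k) ^ x k) *
      y (g q) q ^ (1 - ∑ k, x k) * ∏ k, y (g q + 1) (q + dir k) ^ (outerExponent g M₀ q k - x k)
    let F' : (Fin 4 → ℤ) → OctField := fun x =>
      (∏ k, edgeWeight g s(q, q + dir (k + 2)) ^ x k) * y (g q + 2) q ^ (1 - ∑ k, x k) *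
        ∏ k, y (g q + 1) (q + dir k) ^ (outerExponent g' M₀ q k - x k)
    rw [Finset.sum_congr rfl (g := fun M => outerMonomial y g₀ M₀ q *
        F (fun k => ind M q (q + dir k))),
      Finset.sum_congr (s₁ := hfin'.toFinset.filter _) rfl (g := fun M => outerMonomial y g₀ M₀ q *
        F' (fun k => ind M q (q + dir k))),
      ← Finset.mul_sum, ← Finset.mul_sum, sum_fiber hflat hg₀ hM₀ hout _ hS F,
      sum_fiber hflat' hg₀' hM₀ hout _ hS' F']
    · congr 1
      have hT : ∀ k, demand g M₀ q k = 0 ∨ demand g M₀ q k = 1 := by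
        intro k
        have := hout k
        rw [demand]
        split_ifs <;> omega
      have hT' : ∀ k, demand g' M₀ q k = 1 - demand g M₀ q k := by
        intro k
        have := hD k
        rw [demand, demand, hD', hq]
        split_ifs <;> omega
      refine sum_bits_renewal (fun k => edgeWeight g s(q, q + dir k))
        (fun k => y (g q + 1) (q + dir k)) _ _ (fun k => hy _ _) (hy _ _) (hy _ _) hrec
        (demand g M₀ q) (demand g' M₀ q) (outerExponent g M₀ q) (outerExponent g' M₀ q) hT hT' ?_
      -- The change of exponent at a neighbour comes from the two middle edges that appear or
      -- disappear at its corners shared with `q`.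
      intro k
      have h1 := hD k
      have h2 := hD (k + 3)
      have h3 := hout k
      have h4 := hout (k + 3)
      rw [outerExponent, outerExponent, outerBalance_congr hgg rfl, demand, demand, hD', hD', hq]
      split_ifs <;> omega
    · intro M hM
      rw [Finset.mem_filter, Set.Finite.mem_toFinset, Set.mem_ofPred_eq] at hM
      rw [heightMonomial_eq y hflat' hM.1 (hexp' M hM.1), outerMonomial_congr y hg₀' hM.2]
      simp only [outerExponent_congr hM.2, hw, hq, hloc', F']
    · intro M hM
      rw [Finset.mem_filter, Set.Finite.mem_toFinset, Set.mem_ofPred_eq] at hM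
      rw [heightMonomial_eq y hflat hM.1 (hexp M hM.1), outerMonomial_congr y hg₀ hM.2]
      simp only [outerExponent_congr hM.2, hloc, F]
  rw [finsum_mem_eq_finite_toFinset_sum _ hfin, finsum_mem_eq_finite_toFinset_sum _ hfin',
    ← Finset.sum_fiberwise_of_maps_to (s := hfin.toFinset) (g := fun M => M \ localEdges q)
      (t := (hfin.toFinset ∪ hfin'.toFinset).image fun M => M \ localEdges q)
      (fun M hM => Finset.mem_image_of_mem _ (Finset.mem_union_left _ hM)),
    ← Finset.sum_fiberwise_of_maps_to (s := hfin'.toFinset) (g := fun M => M \ localEdges q)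
      (t := (hfin.toFinset ∪ hfin'.toFinset).image fun M => M \ localEdges q)
      (fun M hM => Finset.mem_image_of_mem _ (Finset.mem_union_right _ hM))]
  refine Finset.sum_congr rfl fun O hO => ?_
  obtain ⟨M₀, hM₀, rfl⟩ := Finset.mem_image.1 hO
  rw [Finset.mem_union, Set.Finite.mem_toFinset, Set.Finite.mem_toFinset] at hM₀
  rcases hM₀ with hM₀ | hM₀
  · exact key g M₀ (fun _ _ => rfl) hflat hM₀
  · exact key g' M₀ (fun p hp => (hgg p hp).symm) hflat' hM₀

/-! ### The solution of the recurrence does not vanish. -/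

/-- Quotients of polynomials that are positive where all variables are `1`. -/
def IsPositiveQuotient (z : OctField) : Prop :=
  ∃ p q : MvPolynomial (Face ⊕ EdgeLabel) ℤ, 0 < MvPolynomial.eval 1 p ∧
    0 < MvPolynomial.eval 1 q ∧ z = algebraMap _ OctField p / algebraMap _ OctField q

theorem algebraMap_ne_zero_of_eval_pos {p : MvPolynomial (Face ⊕ EdgeLabel) ℤ}
    (hp : 0 < MvPolynomial.eval 1 p) : algebraMap _ OctField p ≠ 0 := by
  rw [Ne, FaithfulSMul.algebraMap_eq_zero_iff]
  rintro rfl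
  simp at hp

theorem IsPositiveQuotient.ne_zero {z : OctField} (hz : IsPositiveQuotient z) : z ≠ 0 := by
  obtain ⟨p, q, hp, hq, rfl⟩ := hz
  exact div_ne_zero (algebraMap_ne_zero_of_eval_pos hp) (algebraMap_ne_zero_of_eval_pos hq)

theorem IsPositiveQuotient.mul {z w : OctField} (hz : IsPositiveQuotient z)
    (hw : IsPositiveQuotient w) : IsPositiveQuotient (z * w) := by
  obtain ⟨p, q, hp, hq, rfl⟩ := hz
  obtain ⟨p', q', hp', hq', rfl⟩ := hw
  exact ⟨p * p', q * q', by rw [map_mul]; positivity, by rw [map_mul]; positivity,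
    by rw [map_mul, map_mul, div_mul_div_comm]⟩

theorem IsPositiveQuotient.div {z w : OctField} (hz : IsPositiveQuotient z)
    (hw : IsPositiveQuotient w) : IsPositiveQuotient (z / w) := by
  obtain ⟨p, q, hp, hq, rfl⟩ := hz
  obtain ⟨p', q', hp', hq', rfl⟩ := hw
  exact ⟨p * q', q * p', by rw [map_mul]; positivity, by rw [map_mul]; positivity,
    by rw [map_mul, map_mul, div_div_div_eq]⟩

theorem IsPositiveQuotient.add {z w : OctField} (hz : IsPositiveQuotient z)
    (hw : IsPositiveQuotient w) : IsPositiveQuotient (z + w) := by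
  obtain ⟨p, q, hp, hq, rfl⟩ := hz
  obtain ⟨p', q', hp', hq', rfl⟩ := hw
  exact ⟨p * q' + q * p', q * q', by rw [map_add, map_mul, map_mul]; positivity,
    by rw [map_mul]; positivity, by
      rw [map_add, map_mul, map_mul, map_mul, div_add_div _ _ (algebraMap_ne_zero_of_eval_pos hq)
        (algebraMap_ne_zero_of_eval_pos hq')]⟩

theorem isPositiveQuotient_faceVar (p : Face) : IsPositiveQuotient (faceVar p) :=
  ⟨MvPolynomial.X (Sum.inl p), 1, by simp, by simp, by simp [faceVar]⟩

theorem isPositiveQuotient_edgeVar (s : EdgeSymbol) (i j : ℤ) :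
    IsPositiveQuotient (edgeVar s i j) := by
  rw [edgeVar]
  split_ifs with h
  · exact ⟨MvPolynomial.X (Sum.inr (⟨(i, j), h⟩, s)), 1, by simp, by simp, by simp⟩
  · exact ⟨1, 1, by simp, by simp, by simp⟩

theorem octF_of_mem {h : Face → ℤ} (hh : IsHeightFunction h) {n i j : ℤ}
    (hP : (n, i, j) ∈ upperSet h) : octF h hh n i j =
      (edgeVar .a (i + n - 1) j * edgeVar .c (i - n + 1) j *
          octF h hh (n - 1) i (j + 1) * octF h hh (n - 1) i (j - 1) +
        edgeVar .b i (j + n - 1) * edgeVar .d i (j - n + 1) *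
          octF h hh (n - 1) (i + 1) j * octF h hh (n - 1) (i - 1) j) / octF h hh (n - 2) i j := by
  rw [octF, dif_pos hP]

theorem octF_of_notMem {h : Face → ℤ} (hh : IsHeightFunction h) {n i j : ℤ}
    (hP : (n, i, j) ∉ upperSet h) : octF h hh n i j = faceVar (i, j) := by
  rw [octF, dif_neg hP]

/-- The recurrence contains no subtraction. Nonvanishing makes its divisions and the negative powers
in the monomials genuine. -/
theorem isPositiveQuotient_octF {h : Face → ℤ} (hh : IsHeightFunction h) (n i j : ℤ) :
    IsPositiveQuotient (octF h hh n i j) := by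
  induction n, i, j using octF.induct h hh with
  | case1 n i j hP ih1 ih2 ih3 ih4 ih5 =>
    rw [octF_of_mem hh hP]
    exact ((((isPositiveQuotient_edgeVar _ _ _).mul (isPositiveQuotient_edgeVar _ _ _)).mul
      ih1).mul ih2 |>.add ((((isPositiveQuotient_edgeVar _ _ _).mul
        (isPositiveQuotient_edgeVar _ _ _)).mul ih3).mul ih4)).div ih5
  | case2 n i j hP =>
    rw [octF_of_notMem hh hP]
    exact isPositiveQuotient_faceVar _

/-! ### Raising the truncated function to the cone. -/

theorem finite_lt_coneFun {h : Face → ℤ} (hh : IsHeightFunction h) {P : ℤ × ℤ × ℤ}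
    (hP : P ∈ octLattice) : {q | h q < coneFun P q}.Finite := by
  refine Set.Finite.of_finite_image (f := fun q => (coneFun P q, q))
    ((finite_upperSet_inter_octCone hh P).subset ?_) fun q _ q' _ h => congrArg Prod.snd h
  rintro _ ⟨q, hq, rfl⟩
  have := (isPseudoHeightFunction_coneFun hP).parity q
  exact ⟨⟨this, hq⟩, this, le_rfl⟩

theorem isPseudoHeightFunction_truncated {h : Face → ℤ} (hh : IsPseudoHeightFunction h)
    {P : ℤ × ℤ × ℤ} (hP : P ∈ octLattice) : IsPseudoHeightFunction (truncated h P) :=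
  hh.min (isPseudoHeightFunction_coneFun hP)

theorem truncated_le_coneFun (h : Face → ℤ) (P : ℤ × ℤ × ℤ) (q : Face) :
    truncated h P q ≤ coneFun P q := min_le_right _ _

theorem octF_recurrence {h : Face → ℤ} (hh : IsHeightFunction h) {g : Face → ℤ} {q : Face}
    (hloc : ∀ k, g (q + dir k) = g q + 1) (hq : (g q + 2, q) ∈ upperSet h) :
    octF h hh (g q + 2) q.1 q.2 * octF h hh (g q) q.1 q.2 =
      edgeWeight g s(q, q + dir 0) * edgeWeight g s(q, q + dir 2) *
        (octF h hh (g q + 1) (q + dir 1).1 (q + dir 1).2 *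
          octF h hh (g q + 1) (q + dir 3).1 (q + dir 3).2) +
      edgeWeight g s(q, q + dir 1) * edgeWeight g s(q, q + dir 3) *
        (octF h hh (g q + 1) (q + dir 0).1 (q + dir 0).2 *
          octF h hh (g q + 1) (q + dir 2).1 (q + dir 2).2) := by
  obtain ⟨i, j⟩ := q
  obtain ⟨w0, w1, w2, w3⟩ := edgeWeight_inner hloc
  have e1 : g (i, j) + 2 - 1 = g (i, j) + 1 := by ring
  have e2 : g (i, j) + 2 - 2 = g (i, j) := by ring
  have hne := (isPositiveQuotient_octF hh (g (i, j)) i j).ne_zero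
  rw [w0, w1, w2, w3, octF_of_mem hh hq, e1, e2, div_mul_cancel₀ _ hne]
  simp only [dir, Matrix.cons_val, Prod.mk_add_mk, add_zero, ← sub_eq_add_neg]
  ring

theorem exists_isPseudoHeightFunction_raise {P : ℤ × ℤ × ℤ} (hP : P ∈ octLattice) {g : Face → ℤ}
    (hg : IsPseudoHeightFunction g) (hle : ∀ q, g q ≤ coneFun P q)
    (hfin : {q | g q < coneFun P q}.Finite) (hne : {q | g q < coneFun P q}.Nonempty) :
    ∃ q, g q < coneFun P q ∧ (∀ k, g (q + dir k) = g q + 1) ∧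
      IsPseudoHeightFunction (Function.update g q (g q + 2)) ∧
      ∀ p, Function.update g q (g q + 2) p ≤ coneFun P p := by
  -- A lower neighbour of the lowest face below the cone would itself lie below the cone.
  obtain ⟨q, hq, hmin⟩ := Set.exists_min_image _ g hfin hne
  -- A positive even gap is at least 2, so raising by 2 stays within the cone.
  have hpar : ∀ p, (coneFun P p - g p) % 2 = 0 := by
    intro p
    have h1 := (isPseudoHeightFunction_coneFun hP).parity p
    have h2 := hg.parity p
    simp only [octLattice, Set.mem_ofPred_eq, Int.ModEq] at h1 h2
    omega
  have hq' : g q < coneFun P q := hq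
  have hloc : ∀ k, g (q + dir k) = g q + 1 := by
    intro k
    rcases hg.dir_eq q k with h | h
    · exact h
    · exfalso
      have h1 := hpar q
      have h2 : g (q + dir k) < coneFun P (q + dir k) := by
        rcases coneFun_dir (P := P) q k with h3 | h3 <;> omega
      have := hmin _ h2
      omega
  have hstep : ∀ p k, Function.update g q (g q + 2) (p + dir k) =
      Function.update g q (g q + 2) p + 1 ∨ Function.update g q (g q + 2) (p + dir k) =
      Function.update g q (g q + 2) p - 1 := by
    intro p k
    by_cases hp : p = q
    · subst hp
      rw [Function.update_self, Function.update_of_ne (by simp [dir_ne_zero]), hloc]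
      omega
    · rw [Function.update_of_ne hp]
      by_cases hpk : p + dir k = q
      · have : p = q + dir (k + 2) := by rw [dir_add_two, ← hpk]; abel
        rw [hpk, Function.update_self, this, hloc]
        omega
      · rw [Function.update_of_ne hpk]
        exact hg.dir_eq p k
  refine ⟨q, hq, hloc, ⟨fun p r hpr => ?_, fun p => ?_⟩, fun p => ?_⟩
  · obtain ⟨k, rfl⟩ := latticeAdjacent_iff.1 hpr
    rcases hstep p k with h | h <;> rw [h] <;> simp
  · by_cases hp : p = q
    · subst hp
      have := hg.parity p
      rw [Function.update_self]
      simp only [octLattice, Set.mem_ofPred_eq, Int.ModEq] at this ⊢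
      omega
    · rw [Function.update_of_ne hp]
      exact hg.parity p
  · by_cases hp : p = q
    · subst hp
      have := hpar p
      rw [Function.update_self]
      omega
    · rw [Function.update_of_ne hp]
      exact hle p

/-- Induction on the total gap to the cone, summed over a fixed finite set outside of which `g`
equals `coneFun P`. -/
theorem finsum_heightMonomial_eq_octF {h : Face → ℤ} (hh : IsHeightFunction h) {P : ℤ × ℤ × ℤ}
    (hP : P ∈ octLattice) (N : ℕ) {g : Face → ℤ} (hg : IsPseudoHeightFunction g)
    (hle : ∀ q, g q ≤ coneFun P q) (hge : ∀ q, truncated h P q ≤ g q)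
    (hN : ∑ q ∈ (finite_lt_coneFun hh hP).toFinset, (coneFun P q - g q).toNat = N) :
    ∑ᶠ M ∈ {M | ConeMatching P g M}, heightMonomial (fun n p => octF h hh n p.1 p.2) g M =
      octF h hh P.1 P.2.1 P.2.2 := by
  -- Below the cone the truncation is `h` itself. Hence a raised point lies strictly above `h`,
  -- where the recurrence holds.
  have hlt : ∀ g' : Face → ℤ, (∀ q, truncated h P q ≤ g' q) →
      ∀ q, g' q < coneFun P q → h q < coneFun P q ∧ h q ≤ g' q := by
    intro g' hge' q hq
    have := hge' q
    rw [truncated] at this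
    omega
  have hfin : ∀ g' : Face → ℤ, (∀ q, truncated h P q ≤ g' q) → (∀ q, g' q ≤ coneFun P q) →
      {q | g' q ≠ coneFun P q}.Finite := fun g' hge' hle' =>
    (finite_lt_coneFun hh hP).subset fun q hq => (hlt g' hge' q (lt_of_le_of_ne (hle' q) hq)).1
  induction N using Nat.strong_induction_on generalizing g with
  | _ N ih =>
    by_cases hne : {q | g q < coneFun P q}.Nonempty
    · obtain ⟨q, hq, hloc, hg', hle'⟩ := exists_isPseudoHeightFunction_raise hP hg hle
        ((hfin g hge hle).subset fun q hq => ne_of_lt hq) hne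
      have hhq := hlt g hge q hq
      have hge' : ∀ p, truncated h P p ≤ Function.update g q (g q + 2) p := by
        intro p
        have := hge p
        by_cases hp : p = q
        · subst hp
          rw [Function.update_self]
          omega
        · rwa [Function.update_of_ne hp]
      rw [← ih _ ?_ hg' hle' hge' rfl]
      · refine finsum_heightMonomial_renewal
          (fun n p => (isPositiveQuotient_octF hh n p.1 p.2).ne_zero) hg
          (fun p hp => Function.update_of_ne hp _ _) hloc (Function.update_self _ _ _)
          (finite_setOf_coneMatching hg hle (hfin g hge hle))
          (finite_setOf_coneMatching hg' hle' (hfin _ hge' hle'))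
          (fun M hM => finite_faceExponent_ne_zero hg hle (hfin g hge hle) hM)
          (fun M hM => finite_faceExponent_ne_zero hg' hle' (hfin _ hge' hle') hM)
          (octF_recurrence hh hloc ⟨?_, ?_⟩)
        · simpa using hg'.parity q
        · simp only
          omega
      · rw [← hN]
        refine Finset.sum_lt_sum (fun p _ => ?_) ⟨q, by simpa using hhq.1, ?_⟩
        · by_cases hp : p = q
          · subst hp
            rw [Function.update_self]
            omega
          · rw [Function.update_of_ne hp]
        · rw [Function.update_self]
          omega
    · have : g = coneFun P := by
        funext q
        exact le_antisymm (hle q) (not_lt.1 fun hq => hne ⟨q, hq⟩)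
      subst this
      rw [finsum_heightMonomial_coneFun hP]

/-! ### The outer graph and acceptable matchings. -/

section OuterGraph

variable {h : Face → ℤ} {P : ℤ × ℤ × ℤ}

theorem exists_latticeAdjacent_of_mem_graphVertices {g : Face → ℤ} {v : Finset Face}
    (hv : v ∈ graphVertices g) {p : Face} (hp : p ∈ v) : ∃ r ∈ v, LatticeAdjacent p r := by
  obtain ⟨i, j, ⟨-, -, rfl⟩ | ⟨-, rfl | rfl⟩ | ⟨-, rfl | rfl⟩⟩ := hv <;>
    simp only [Finset.mem_insert, Finset.mem_singleton] at hp <;>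
    simp only [Finset.exists_mem_insert, Finset.mem_singleton, exists_eq_left] <;>
    (try rcases hp with rfl | rfl | rfl | rfl) <;>
    simp [LatticeAdjacent]

/-- A face below the cone around `v`, together with a lattice neighbour around `v`, gives an edge of
`G_P` that ends at `v`. -/
theorem mem_outVertices_iff (hh : IsPseudoHeightFunction h) {v : Finset Face} :
    v ∈ outVertices h P ↔ v ∈ graphVertices (truncated h P) ∧
      ∀ p ∈ v, truncated h P p = coneFun P p := by
  refine and_congr_right fun hv => ⟨fun H p hp => ?_, ?_⟩
  · obtain ⟨r, hr, hpr⟩ := exists_latticeAdjacent_of_mem_graphVertices hv hp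
    by_contra hcon
    have hlt : h p < coneFun P p := by
      rw [truncated] at hcon
      omega
    refine H s(p, r) ⟨mem_graphEdges.2 (Or.inl hpr), p, by simp, hh.parity p, hlt⟩ ?_
    simp [EndsAt, hp, hr]
  · rintro H e ⟨-, p, hpe, -, hp⟩ he
    have := H p (he p hpe)
    rw [truncated] at this
    simp only at hp
    omega

/-- The function `g` is the cone function on the square at the corner `k` of `q`, and the square
contains a wrench whose middle edge does not border `q`. -/
structure IsConeWrench (P : ℤ × ℤ × ℤ) (g : Face → ℤ) (q : Face) (k : Fin 4) : Prop where
  corner : g q = coneFun P q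
  right : g (q + dir k) = coneFun P (q + dir k)
  left : g (q + dir (k + 1)) = coneFun P (q + dir (k + 1))
  opposite : g (q + dir k + dir (k + 1)) = coneFun P (q + dir k + dir (k + 1))
  ne : coneFun P q ≠ coneFun P (q + dir k + dir (k + 1))

/-- If `g` differs on the diagonal from `q`, the two other faces have equal heights, half-way
between. The value at the fourth face is then determined, and for the cone function it is the same.
-/
theorem isConeWrench_of_ne {g : Face → ℤ} (hg : IsPseudoHeightFunction g) {q : Face} {k : Fin 4}
    (hA : g q = coneFun P q) (hB : g (q + dir k) = coneFun P (q + dir k))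
    (hC : g (q + dir (k + 1)) = coneFun P (q + dir (k + 1)))
    (hne : g q ≠ g (q + dir k + dir (k + 1))) : IsConeWrench P g q k := by
  have h1 := coneFun_add_dir_add_dir (P := P) q k
  have h2 := hg.dir_eq q k
  have h3 := hg.dir_eq q (k + 1)
  have h4 := hg.dir_eq (q + dir k) (k + 1)
  have h5 := hg.dir_eq (q + dir (k + 1)) k
  rw [add_right_comm] at h5
  have h6 := coneFun_ne_iff (P := P) q k
  refine ⟨hA, hB, hC, ?_, h6.2 ?_⟩ <;> omega

theorem exists_isConeWrench {g : Face → ℤ} (hg : IsPseudoHeightFunction g) {v : Finset Face}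
    (hv : v ∈ graphVertices g) (hc : ∀ p ∈ v, g p = coneFun P p) :
    ∃ q k, IsConeWrench P g q k ∧ v = {q, q + dir k, q + dir (k + 1)} := by
  obtain ⟨i, j, ⟨h1, h2, rfl⟩ | ⟨h1, rfl | rfl⟩ | ⟨h1, rfl | rfl⟩⟩ := hv <;>
    simp only [Finset.mem_insert, Finset.mem_singleton, forall_eq_or_imp, forall_eq] at hc
  -- A cross would need both diagonals constant, which the cone function never allows.
  · exfalso
    have := coneFun_ne_iff (P := P) (i, j) 0
    simp [dir] at this
    omega
  · exact ⟨(i, j), 0, isConeWrench_of_ne hg (by simp [hc]) (by simp [dir, hc])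
      (by simp [dir, hc]) (by simpa [dir] using h1), by simp [dir]⟩
  · exact ⟨(i + 1, j + 1), 2, isConeWrench_of_ne hg (by simp [hc]) (by simp [dir, hc])
      (by simp [dir, hc]) (by simpa [dir] using h1.symm), by simp [dir, Finset.pair_comm]⟩
  · exact ⟨(i + 1, j), 1, isConeWrench_of_ne hg (by simp [hc]) (by simp [dir, hc])
      (by simp [dir, hc]) (by simpa [dir] using h1), by simp [dir, Finset.pair_comm]⟩
  · exact ⟨(i, j + 1), 3, isConeWrench_of_ne hg (by simp [hc]) (by simp [dir, hc])
      (by simp [dir, hc]) (by simpa [dir] using h1.symm), by simp [dir]⟩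

theorem exists_square_of_mem_graphVertices {g : Face → ℤ} {v : Finset Face}
    (hv : v ∈ graphVertices g) :
    ∃ i j : ℤ, ∀ p ∈ v, (p.1 = i ∨ p.1 = i + 1) ∧ (p.2 = j ∨ p.2 = j + 1) := by
  obtain ⟨i, j, ⟨-, -, rfl⟩ | ⟨-, rfl | rfl⟩ | ⟨-, rfl | rfl⟩⟩ := hv <;>
    exact ⟨i, j, by simp⟩

theorem middle_mem_outMatching (hh : IsPseudoHeightFunction h) {q : Face} {k : Fin 4}
    (hw : IsConeWrench P (truncated h P) q k) :
    s(q + dir k, q + dir (k + 1)) ∈ outMatching h P := by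
  have hu : s(q + dir k, q + dir (k + 1)) ∈ unweightedEdges (truncated h P) := by
    rw [mem_unweightedEdges_antidiagonal, hw.corner, hw.opposite]
    exact hw.ne
  refine ⟨⟨hu.1, fun v hv he => ?_⟩, hu⟩
  rw [mem_outVertices_iff hh]
  refine ⟨hv, fun p hp => ?_⟩
  -- Two diagonal neighbours lie in only one unit square, so both ends of the middle edge belong to
  -- the square of `q`.
  obtain ⟨i, j, hij⟩ := exists_square_of_mem_graphVertices hv
  have hB := hij _ (he _ (Sym2.mem_mk_left _ _))
  have hC := hij _ (he _ (Sym2.mem_mk_right _ _))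
  have hp' := hij p hp
  have key : p = q ∨ p = q + dir k ∨ p = q + dir (k + 1) ∨ p = q + dir k + dir (k + 1) := by
    obtain ⟨a, b⟩ := q
    obtain ⟨c, d⟩ := p
    clear hw hu he hp
    fin_cases k <;> simp [dir, Prod.ext_iff] at hB hC hp' ⊢ <;> omega
  rcases key with rfl | rfl | rfl | rfl
  exacts [hw.corner, hw.right, hw.left, hw.opposite]

theorem existsUnique_mem_outMatching (hh : IsPseudoHeightFunction h) {q : Face} {k : Fin 4}
    (hw : IsConeWrench P (truncated h P) q k) :
    ∃! e, e ∈ outMatching h P ∧ EndsAt e {q, q + dir k, q + dir (k + 1)} := by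
  refine ⟨_, ⟨middle_mem_outMatching hh hw, by simp [EndsAt]⟩, ?_⟩
  rintro e ⟨⟨-, he, a, b, rfl, hab⟩, hev⟩
  have ha := hev a (by simp)
  have hb := hev b (by simp)
  have hne : a ≠ b := by
    rintro rfl
    exact not_borders_self _ _ (mem_graphEdges.1 he)
  have hB : LatticeAdjacent q (q + dir k) := latticeAdjacent_iff.2 ⟨k, rfl⟩
  have hC : LatticeAdjacent q (q + dir (k + 1)) := latticeAdjacent_iff.2 ⟨k + 1, rfl⟩
  clear hw hev he
  generalize q + dir k = B at *
  generalize q + dir (k + 1) = C at *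
  have hB' := latticeAdjacent_comm.1 hB
  have hC' := latticeAdjacent_comm.1 hC
  simp only [Finset.mem_insert, Finset.mem_singleton] at ha hb
  rcases ha with rfl | rfl | rfl <;> rcases hb with rfl | rfl | rfl <;>
    first | contradiction | rfl | exact Sym2.eq_swap

theorem mem_outMatching_iff_of_agreesAround (hh : IsPseudoHeightFunction h) {q : Face}
    (hq : AgreesAround P (truncated h P) q) {e : Sym2 Face} (he : q ∈ e) :
    e ∈ outMatching h P ↔ e ∈ unweightedEdges (coneFun P) := by
  obtain ⟨r, rfl⟩ := Sym2.mem_iff_exists.1 he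
  by_cases hr : ∃ k, r = q + dir k + dir (k + 1)
  · obtain ⟨k, rfl⟩ := hr
    constructor
    · rintro ⟨-, hu⟩
      rw [mem_unweightedEdges_diagonal] at hu ⊢
      rwa [← hq.2.1, ← hq.2.1]
    · intro hu
      rw [mem_unweightedEdges_diagonal] at hu
      have e2 : k + 1 + 1 = k + 2 := by rw [add_assoc]; rfl
      have d2 := dir_add_two k
      have a2 : q + dir k + dir (k + 1 + 1) = q := by rw [e2, d2]; abel
      have a3 : q + dir k + dir (k + 1) + dir (k + 1 + 1) = q + dir (k + 1) := by
        rw [e2, d2]; abel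
      -- Seen from the corner `q + dir k`, the diagonal at `q` is the middle edge of the wrench.
      have hw : IsConeWrench P (truncated h P) (q + dir k) (k + 1) :=
        ⟨hq.2.1 k, hq.2.2 k, by rw [a2]; exact hq.1, by rw [a3]; exact hq.2.1 _, by rwa [a3]⟩
      have := middle_mem_outMatching hh hw
      rwa [a2, Sym2.eq_swap] at this
  · have hn : ∀ g : Face → ℤ, s(q, r) ∉ unweightedEdges g := by
      intro g hu
      rcases borders_iff.1 (mem_graphEdges.1 hu.1) with ⟨k, rfl⟩ | ⟨k, rfl, -⟩
      exacts [not_mem_unweightedEdges_lattice g q k hu, hr ⟨k, rfl⟩]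
    exact iff_of_false (fun h' => hn _ h'.2) (hn _)

/-- The two reference sets `outMatching h P` and `unweightedEdges (coneFun P)` differ in finitely
many edges only, so being close to one means being close to the other. -/
theorem isAcceptable_iff (hh : IsPseudoHeightFunction h)
    (hfin : {q | truncated h P q ≠ coneFun P q}.Finite) {M : Set (Sym2 Face)} :
    IsAcceptable h P M ↔ ConeMatching P (truncated h P) M := by
  refine and_congr_right fun _ => ?_
  have h1 := finite_not_agreesAround hfin
  have h2 : (symmDiff (outMatching h P) (unweightedEdges (coneFun P))).Finite := by
    refine ((h1.prod h1).image (fun x : Face × Face => s(x.1, x.2))).subset fun e he => ?_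
    have h3 : ∀ q ∈ e, ¬ AgreesAround P (truncated h P) q := by
      intro q hqe hq
      have := mem_outMatching_iff_of_agreesAround hh hq hqe
      rw [Set.mem_symmDiff] at he
      tauto
    induction e with | _ a b
    exact ⟨(a, b), ⟨h3 a (by simp), h3 b (by simp)⟩, rfl⟩
  constructor
  · intro H
    exact (H.union h2).subset (symmDiff_triangle _ _ _)
  · intro H
    rw [symmDiff_comm] at h2
    exact (H.union h2).subset (symmDiff_triangle _ _ _)

theorem isMatchingOf_outMatching (hh : IsPseudoHeightFunction h) (hP : P ∈ octLattice) :
    IsMatchingOf (outVertices h P) (outEdges h P) (outMatching h P) := by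
  refine ⟨Set.inter_subset_left, fun v hv => ?_⟩
  rw [mem_outVertices_iff hh] at hv
  obtain ⟨q, k, hw, rfl⟩ := exists_isConeWrench (isPseudoHeightFunction_truncated hh hP) hv.1 hv.2
  exact existsUnique_mem_outMatching hh hw

/-- Both matchings have exactly one edge at `v`, and both contain the middle edge of the wrench
there. -/
theorem mem_iff_mem_outMatching (hh : IsPseudoHeightFunction h) (hP : P ∈ octLattice)
    {M : Set (Sym2 Face)} (hM : ConeMatching P (truncated h P) M) {v : Finset Face}
    (hv : v ∈ outVertices h P) {e : Sym2 Face} (he : EndsAt e v) :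
    e ∈ M ↔ e ∈ outMatching h P := by
  rw [mem_outVertices_iff hh] at hv
  have hg := isPseudoHeightFunction_truncated hh hP
  obtain ⟨hvg, hv⟩ := hv
  have hu := hM.1.2 v hvg
  obtain ⟨q, k, hw, rfl⟩ := exists_isConeWrench hg hvg hv
  have hu' := existsUnique_mem_outMatching hh hw
  have h1 := (middle_mem hg (truncated_le_coneFun h P) hM hw.corner hw.right hw.left
    hw.opposite).1 hw.ne
  have h2 := middle_mem_outMatching hh hw
  have h3 : EndsAt s(q + dir k, q + dir (k + 1)) {q, q + dir k, q + dir (k + 1)} := by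
    simp [EndsAt]
  constructor
  · intro h
    rwa [hu.unique ⟨h, he⟩ ⟨h1, h3⟩]
  · intro h
    rwa [hu'.unique ⟨h, he⟩ ⟨h2, h3⟩]

end OuterGraph

/-- `octF` takes the value `faceVar` on and below the graph of `h`, also where the cone cuts
strictly below it. -/
theorem matchingMonomial_truncated {h : Face → ℤ} (hh : IsHeightFunction h) (P : ℤ × ℤ × ℤ)
    (M : Set (Sym2 Face)) : matchingMonomial (truncated h P) M =
      heightMonomial (fun n p => octF h hh n p.1 p.2) (truncated h P) M := by
  have : ∀ p : Face, octF h hh (truncated h P p) p.1 p.2 = faceVar p := fun p =>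
    octF_of_notMem hh fun hp => absurd hp.2 (not_lt.2 (min_le_left _ _))
  simp only [matchingMonomial, heightMonomial, this]

theorem mainTheorem7 (h : Face → ℤ) (hh : IsHeightFunction h) (n₀ i₀ j₀ : ℤ)
    (hP : (n₀, i₀, j₀) ∈ upperSet h) :
    IsPseudoHeightFunction (truncated h (n₀, i₀, j₀)) ∧
    IsMatchingOf (outVertices h (n₀, i₀, j₀)) (outEdges h (n₀, i₀, j₀))
      (outMatching h (n₀, i₀, j₀)) ∧
    (∀ M, IsAcceptable h (n₀, i₀, j₀) M →
      (∀ v ∈ outVertices h (n₀, i₀, j₀), ∀ e, EndsAt e v →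
        (e ∈ M ↔ e ∈ outMatching h (n₀, i₀, j₀)))) ∧
    (∀ M, IsAcceptable h (n₀, i₀, j₀) M →
      {e | e ∈ M ∧ edgeWeight (truncated h (n₀, i₀, j₀)) e ≠ 1}.Finite ∧
      {p | faceExponent (truncated h (n₀, i₀, j₀)) M p ≠ 0}.Finite) ∧
    {M | IsAcceptable h (n₀, i₀, j₀) M}.Finite ∧
    octF h hh n₀ i₀ j₀ =
      ∑ᶠ M ∈ {M | IsAcceptable h (n₀, i₀, j₀) M},
        matchingMonomial (truncated h (n₀, i₀, j₀)) M := by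
  have hL := hP.1
  have hps := isPseudoHeightFunction_truncated hh.toIsPseudoHeightFunction hL
  have hle := truncated_le_coneFun h (n₀, i₀, j₀)
  have hfin : {q | truncated h (n₀, i₀, j₀) q ≠ coneFun (n₀, i₀, j₀) q}.Finite := by
    refine (finite_lt_coneFun hh hL).subset fun q hq => ?_
    simp only [Set.mem_ofPred_eq, truncated] at hq ⊢
    omega
  have hacc : ∀ {M}, IsAcceptable h (n₀, i₀, j₀) M ↔
      ConeMatching (n₀, i₀, j₀) (truncated h (n₀, i₀, j₀)) M :=
    isAcceptable_iff hh.toIsPseudoHeightFunction hfin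
  simp only [hacc, matchingMonomial_truncated hh]
  exact ⟨hps, isMatchingOf_outMatching hh.toIsPseudoHeightFunction hL,
    fun M hM v hv e he => mem_iff_mem_outMatching hh.toIsPseudoHeightFunction hL hM hv he,
    fun M hM => ⟨hM.finite_edgeWeight_ne_one _, finite_faceExponent_ne_zero hps hle hfin hM⟩,
    finite_setOf_coneMatching hps hle hfin,
    (finsum_heightMonomial_eq_octF hh hL _ hps hle (fun _ => le_rfl) rfl).symm⟩
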